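/- Let $\mathcal O\subset\mathbb R^d$ be a bounded, connected, nonempty open set with $C^2$ boundary (locally on one side of it), let $\nu$ be its outer unit normal, and let $b_1,\dots,b_N\in C^2(\overline{\mathcal O};\mathbb R^d)$ satisfy, for all $1\le i\le N$: (i) $\langle b_i,\nu\rangle=0$ on $\partial\mathcal O$; (ii) $\sum_{k} b_i^k\,\partial_k b_l^j=\sum_k b_l^k\,\partial_k b_i^j$ on $\overline{\mathcal O}$ for all $1\le j\le d$ and all $l\ne i$ (no condition if $N=1$); (iii) $\operatorname{div} b_i=0$ and $\langle\Delta b_i,b_i\rangle=0$ on $\overline{\mathcal O}$, where $\Delta$ acts componentwise; (iv) $\langle (Db_i)\,\nu,b_i\rangle+\langle (Db_i)\,b_i,\nu\rangle=0$ on $\partial\mathcal O$, where $Db_i=(\partial_k b_i^j)_{j,k}$. Let $\Delta$ denote the Neumann Laplacian in $L^2(\mathcal O)$: $u\in\operatorname{dom}(\Delta)=\operatorname{dom}(-\Delta)$ and $\Delta u=f$ if and only if $u\in H^1(\mathcal O)$, $f\in L^2(\mathcal O)$ and $\int_{\mathcal O}vf\,d\xi=-\int_{\mathcal O}\langle\nabla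 v,\nabla u\rangle\,d\xi$ for all $v\in H^1(\mathcal O)$. Let $B_iu:=\langle b_i,\nabla u\rangle$ with $\operatorname{dom}(B_i)=H^1(\mathcal O)$ (this is well defined in $L^2(\mathcal O)$), and let $B_i^*$ be its adjoint in $L^2(\mathcal O)$. Then for every $1\le i\le N$ there is a linear subspace $\mathcal D\subseteq\operatorname{dom}(-\Delta)$ such that 1. $\Delta(\mathcal D)\subseteq\operatorname{dom}(B_i)$; 2. $B_i(\mathcal D)\subseteq\operatorname{dom}(-\Delta)$; 3. $\mathcal D$ is a core for $-\Delta$, i.e. dense in $\operatorname{dom}(-\Delta)$ for the graph norm $(\|\Delta u\|_{L^2}^2+\|u\|_{L^2}^2)^{1/2}$; 4. $\operatorname{dom}(-\Delta)\subseteq\operatorname{dom}(B_i)$ and $\operatorname{dom}(-\Delta)\subseteq\operatorname{dom}(B_i^*)$; 5. $B_i\Delta u=\Delta B_iu$ for all $u\in\mathcal D$. Consequently, for every $1\le i\le N$ and every $\delta>0$, the resolvent $J_\delta=(\mathrm{Id}-\delta\Delta)^{-1}$ exists as a bounded linear operator on $L^2(\mathcal O)$, and for every $u\in\operatorname{dom}(B_i)$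 one has $J_\delta u\in\operatorname{dom}(B_i)$ and $B_iJ_\delta u=J_\delta B_iu$. -/

import Mathlib

open MeasureTheory Set Filter Topology
open scoped ContDiff InnerProductSpace RealInnerProductSpace

noncomputable section

namespace NeumannKilling

/-- Euclidean space `ℝ^d`. -/
abbrev Eu (d : ℕ) : Type := EuclideanSpace ℝ (Fin d)

/-- The real Hilbert space `L²(O)` with respect to Lebesgue measure. -/
abbrev L2 {d : ℕ} (O : Set (Eu d)) : Type := Lp ℝ 2 ((volume : Measure (Eu d)).restrict O)

/-- The real Hilbert space `L²(O; ℝ^d)` of square integrable vector fields. -/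
abbrev L2Vec {d : ℕ} (O : Set (Eu d)) : Type :=
  Lp (Eu d) 2 ((volume : Measure (Eu d)).restrict O)

/-! ### Domains with `C²` boundary and their outer unit normal -/

/-- `φ` is a `C²` defining function of `O` near the point `x`: it is of class `C²`, its differential
at `x` does not vanish, and near `x` the set `O` is the sublevel set `{φ < 0}`. -/
structure IsDefiningFunctionAt {d : ℕ} (O : Set (Eu d)) (x : Eu d) (φ : Eu d → ℝ) : Prop where
  contDiff : ContDiff ℝ 2 φ
  gradient_ne_zero : gradient φ x ≠ 0
  eventually_mem_iff : ∀ᶠ y in 𝓝 x, (y ∈ O ↔ φ y < 0)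

/-- The boundary of `O` is of class `C²`, with `O` locally on one side of its boundary. -/
def HasC2Boundary {d : ℕ} (O : Set (Eu d)) : Prop :=
  ∀ x ∈ frontier O, ∃ φ : Eu d → ℝ, IsDefiningFunctionAt O x φ

/-- `n` is the outer unit normal of `O` at the boundary point `x`. -/
def IsOuterUnitNormalAt {d : ℕ} (O : Set (Eu d)) (x n : Eu d) : Prop :=
  ∃ φ : Eu d → ℝ, IsDefiningFunctionAt O x φ ∧ n = ‖gradient φ x‖⁻¹ • gradient φ x

/-! ### The assumptions on the coefficient fields -/

/-- The divergence on `closure O` of a vector field that is differentiable up to the boundary. -/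
def divergence {d : ℕ} (O : Set (Eu d)) (b : Eu d → Eu d) (x : Eu d) : ℝ :=
  ∑ k : Fin d, (fderivWithin ℝ b (closure O) x (EuclideanSpace.single k 1)) k

/-- The assumptions on the coefficient fields `b 1, …, b N` (`ν` is the outer unit normal of `O`).
All derivatives are taken within `closure O`, so that they make sense up to the boundary;
`Δ[closure O]` acts componentwise on vector fields, and `fderivWithin ℝ b (closure O) x v` is the
derivative `(Db)(x) v` of `b` in the direction `v`, whose `j`-th component is
`∑ k, v k * ∂ₖ bʲ(x)`. -/
structure NoiseAssumption {d N : ℕ} (O : Set (Eu d)) (ν : Eu d → Eu d)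
    (b : Fin N → Eu d → Eu d) : Prop where
  contDiffOn : ∀ i, ContDiffOn ℝ 2 (b i) (closure O)
  tangential : ∀ i, ∀ x ∈ frontier O, ⟪b i x, ν x⟫ = 0
  lie_bracket : ∀ i l, i ≠ l → ∀ x ∈ closure O,
    fderivWithin ℝ (b l) (closure O) x (b i x) = fderivWithin ℝ (b i) (closure O) x (b l x)
  divergence_eq_zero : ∀ i, ∀ x ∈ closure O, divergence O (b i) x = 0
  inner_laplacian_eq_zero : ∀ i, ∀ x ∈ closure O, ⟪(Δ[closure O] (b i)) x, b i x⟫ = 0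
  boundary : ∀ i, ∀ x ∈ frontier O,
    ⟪fderivWithin ℝ (b i) (closure O) x (ν x), b i x⟫
      + ⟪fderivWithin ℝ (b i) (closure O) x (b i x), ν x⟫ = 0

/-! ### The Sobolev space `H¹(O)` -/

/-- Smooth functions with compact support contained in `O`. -/
structure IsTestFunction {d : ℕ} (O : Set (Eu d)) (ψ : Eu d → ℝ) : Prop where
  contDiff : ContDiff ℝ ∞ ψ
  hasCompactSupport : HasCompactSupport ψ
  tsupport_subset : tsupport ψ ⊆ O

/-- `g` is the weak gradient of `u` in `O`. -/
def HasWeakGradient {d : ℕ} (O : Set (Eu d)) (u : L2 O) (g : L2Vec O) : Prop :=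
  ∀ ψ : Eu d → ℝ, IsTestFunction O ψ → ∀ v : Eu d,
    ∫ x in O, u x * fderiv ℝ ψ x v = - ∫ x in O, ψ x * ⟪g x, v⟫

theorem IsTestFunction.memLp {d : ℕ} {O : Set (Eu d)} {ψ : Eu d → ℝ} (h : IsTestFunction O ψ) :
    MemLp ψ 2 ((volume : Measure (Eu d)).restrict O) :=
  h.contDiff.continuous.memLp_of_hasCompactSupport h.hasCompactSupport

theorem IsTestFunction.memLp_fderiv {d : ℕ} {O : Set (Eu d)} {ψ : Eu d → ℝ}
    (h : IsTestFunction O ψ) (v : Eu d) :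
    MemLp (fun x => fderiv ℝ ψ x v) 2 ((volume : Measure (Eu d)).restrict O) :=
  ((h.contDiff.continuous_fderiv (by simp)).clm_apply continuous_const).memLp_of_hasCompactSupport
    (h.hasCompactSupport.fderiv_apply (𝕜 := ℝ) v)

theorem integrable_left {d : ℕ} {O : Set (Eu d)} {ψ : Eu d → ℝ} (h : IsTestFunction O ψ)
    (v : Eu d) (u : L2 O) : IntegrableOn (fun x => u x * fderiv ℝ ψ x v) O :=
  (Lp.memLp u).integrable_mul (h.memLp_fderiv v)

theorem integrable_right {d : ℕ} {O : Set (Eu d)} {ψ : Eu d → ℝ} (h : IsTestFunction O ψ)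
    (v : Eu d) (g : L2Vec O) : IntegrableOn (fun x => ψ x * ⟪g x, v⟫) O :=
  h.memLp.integrable_mul ((Lp.memLp g).inner_const v)

/-- The graph of the weak gradient, as a subspace of `L²(O) × L²(O; ℝ^d)`. -/
def weakGradientGraph {d : ℕ} (O : Set (Eu d)) : Submodule ℝ (L2 O × L2Vec O) where
  carrier := {p | HasWeakGradient O p.1 p.2}
  zero_mem' := by
    intro ψ hψ v
    have h1 : (fun x => (0 : L2 O) x * fderiv ℝ ψ x v)
        =ᵐ[(volume : Measure (Eu d)).restrict O] fun _ => (0 : ℝ) := by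
      filter_upwards [Lp.coeFn_zero ℝ 2 ((volume : Measure (Eu d)).restrict O)] with x hx
      rw [hx, Pi.zero_apply, zero_mul]
    have h2 : (fun x => ψ x * ⟪(0 : L2Vec O) x, v⟫)
        =ᵐ[(volume : Measure (Eu d)).restrict O] fun _ => (0 : ℝ) := by
      filter_upwards [Lp.coeFn_zero (Eu d) 2 ((volume : Measure (Eu d)).restrict O)] with x hx
      rw [hx, Pi.zero_apply, inner_zero_left, mul_zero]
    change ∫ x in O, (0 : L2 O) x * fderiv ℝ ψ x v = - ∫ x in O, ψ x * ⟪(0 : L2Vec O) x, v⟫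
    rw [integral_congr_ae h1, integral_congr_ae h2, integral_zero, neg_zero]
  add_mem' := by
    intro p q hp hq ψ hψ v
    have h1 : (fun x => (p.1 + q.1) x * fderiv ℝ ψ x v)
        =ᵐ[(volume : Measure (Eu d)).restrict O]
          fun x => p.1 x * fderiv ℝ ψ x v + q.1 x * fderiv ℝ ψ x v := by
      filter_upwards [Lp.coeFn_add p.1 q.1] with x hx
      rw [hx, Pi.add_apply, add_mul]
    have h2 : (fun x => ψ x * ⟪(p.2 + q.2) x, v⟫)
        =ᵐ[(volume : Measure (Eu d)).restrict O]
          fun x => ψ x * ⟪p.2 x, v⟫ + ψ x * ⟪q.2 x, v⟫ := by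
      filter_upwards [Lp.coeFn_add p.2 q.2] with x hx
      rw [hx, Pi.add_apply, inner_add_left, mul_add]
    have e1 := hp ψ hψ v
    have e2 := hq ψ hψ v
    change ∫ x in O, (p.1 + q.1) x * fderiv ℝ ψ x v = - ∫ x in O, ψ x * ⟪(p.2 + q.2) x, v⟫
    rw [integral_congr_ae h1, integral_congr_ae h2,
      integral_add (integrable_left hψ v p.1) (integrable_left hψ v q.1),
      integral_add (integrable_right hψ v p.2) (integrable_right hψ v q.2), e1, e2]
    ring
  smul_mem' := by
    intro c p hp ψ hψ v
    have h1 : (fun x => (c • p.1) x * fderiv ℝ ψ x v)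
        =ᵐ[(volume : Measure (Eu d)).restrict O] fun x => c * (p.1 x * fderiv ℝ ψ x v) := by
      filter_upwards [Lp.coeFn_smul c p.1] with x hx
      simp [hx, mul_assoc]
    have h2 : (fun x => ψ x * ⟪(c • p.2) x, v⟫)
        =ᵐ[(volume : Measure (Eu d)).restrict O] fun x => c * (ψ x * ⟪p.2 x, v⟫) := by
      filter_upwards [Lp.coeFn_smul c p.2] with x hx
      simp [hx, inner_smul_left, mul_left_comm]
    have e1 := hp ψ hψ v
    change ∫ x in O, (c • p.1) x * fderiv ℝ ψ x v = - ∫ x in O, ψ x * ⟪(c • p.2) x, v⟫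
    rw [integral_congr_ae h1, integral_congr_ae h2, integral_const_mul, integral_const_mul, e1]
    ring

/-- The weak gradient is unique. -/
theorem weakGradient_unique {d : ℕ} {O : Set (Eu d)} (hO : IsOpen O)
    (p : L2 O × L2Vec O) (hp : p ∈ weakGradientGraph O) (h0 : p.1 = 0) : p.2 = 0 := by
  obtain ⟨u, g⟩ := p
  obtain rfl : u = 0 := h0
  have key : ∀ v : Eu d, ∀ᵐ x ∂(volume : Measure (Eu d)), x ∈ O → ⟪g x, v⟫ = 0 := by
    intro v
    have hint : LocallyIntegrableOn (fun x => ⟪g x, v⟫) O (volume : Measure (Eu d)) := by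
      exact locallyIntegrableOn_of_locallyIntegrable_restrict
        (((Lp.memLp g).inner_const v).locallyIntegrable (by norm_num))
    refine hO.ae_eq_zero_of_integral_contDiff_smul_eq_zero hint ?_
    intro ψ h1 h2 h3
    have e := hp ψ ⟨h1, h2, h3⟩ v
    have h4 : (fun x => (0 : L2 O) x * fderiv ℝ ψ x v)
        =ᵐ[(volume : Measure (Eu d)).restrict O] fun _ => (0 : ℝ) := by
      filter_upwards [Lp.coeFn_zero ℝ 2 ((volume : Measure (Eu d)).restrict O)] with x hx
      rw [hx, Pi.zero_apply, zero_mul]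
    have e' : ∫ x in O, ψ x * ⟪g x, v⟫ = 0 := by
      have : ∫ x in O, (0 : L2 O) x * fderiv ℝ ψ x v = - ∫ x in O, ψ x * ⟪g x, v⟫ := e
      rw [integral_congr_ae h4] at this
      simpa using this.symm
    rw [← e']
    refine (setIntegral_eq_integral_of_forall_compl_eq_zero ?_).symm
    intro x hx
    have : ψ x = 0 := image_eq_zero_of_notMem_tsupport (fun h => hx (h3 h))
    simp [this]
  have all : ∀ᵐ x ∂((volume : Measure (Eu d)).restrict O),
      ∀ k : Fin d, ⟪g x, EuclideanSpace.single k (1 : ℝ)⟫ = 0 := by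
    rw [ae_all_iff]
    intro k
    rw [ae_restrict_iff' hO.measurableSet]
    exact key _
  change g = 0
  refine Lp.ext ?_
  filter_upwards [all, Lp.coeFn_zero (Eu d) 2 ((volume : Measure (Eu d)).restrict O)]
    with x hx h0
  rw [h0]
  ext k
  simpa [EuclideanSpace.inner_single_right] using hx k

/-- The Sobolev space `H¹(O) = W^{1,2}(O)`, as a subspace of `L²(O)`. -/
def H1 {d : ℕ} (O : Set (Eu d)) : Submodule ℝ (L2 O) :=
  (weakGradientGraph O).map (LinearMap.fst ℝ (L2 O) (L2Vec O))

theorem mem_H1 {d : ℕ} {O : Set (Eu d)} {u : L2 O} :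
    u ∈ H1 O ↔ ∃ g : L2Vec O, HasWeakGradient O u g := by
  simp only [H1, Submodule.mem_map, Prod.exists, LinearMap.fst_apply]
  constructor
  · rintro ⟨a, g, h, rfl⟩
    exact ⟨g, h⟩
  · rintro ⟨g, h⟩
    exact ⟨u, g, h, rfl⟩

/-! ### The first order operators `u ↦ ⟨b, ∇u⟩` -/

/-- The graph of `u ↦ ⟨b, ∇u⟩`: pairs `(u, f)` with `u ∈ H¹(O)` and `f = ⟨b, ∇u⟩` a.e. in `O`. -/
def transportGraph {d : ℕ} (O : Set (Eu d)) (b : Eu d → Eu d) : Submodule ℝ (L2 O × L2 O) where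
  carrier := {p | ∃ g : L2Vec O, HasWeakGradient O p.1 g ∧
    ∀ᵐ x ∂((volume : Measure (Eu d)).restrict O), p.2 x = ⟪b x, g x⟫}
  zero_mem' := by
    refine ⟨0, (weakGradientGraph O).zero_mem, ?_⟩
    filter_upwards [Lp.coeFn_zero ℝ 2 ((volume : Measure (Eu d)).restrict O),
      Lp.coeFn_zero (Eu d) 2 ((volume : Measure (Eu d)).restrict O)] with x h1 h2
    rw [h2]
    simpa using h1
  add_mem' := by
    rintro p q ⟨g, hg, hp⟩ ⟨k, hk, hq⟩
    refine ⟨g + k, (weakGradientGraph O).add_mem (x := (p.1, g)) (y := (q.1, k)) hg hk, ?_⟩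
    filter_upwards [hp, hq, Lp.coeFn_add p.2 q.2, Lp.coeFn_add g k] with x h1 h2 h3 h4
    rw [Prod.snd_add, h3, h4, Pi.add_apply, Pi.add_apply, inner_add_right, h1, h2]
  smul_mem' := by
    rintro c p ⟨g, hg, hp⟩
    refine ⟨c • g, (weakGradientGraph O).smul_mem (x := (p.1, g)) c hg, ?_⟩
    filter_upwards [hp, Lp.coeFn_smul c p.2, Lp.coeFn_smul c g] with x h1 h2 h3
    rw [Prod.smul_snd, h2, h3, Pi.smul_apply, Pi.smul_apply, inner_smul_right, h1, smul_eq_mul]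

theorem transportGraph_unique {d : ℕ} {O : Set (Eu d)} (hO : IsOpen O) (b : Eu d → Eu d)
    (p : L2 O × L2 O) (hp : p ∈ transportGraph O b) (h0 : p.1 = 0) : p.2 = 0 := by
  obtain ⟨g, hg, h⟩ := hp
  have hg0 : g = 0 := weakGradient_unique hO (p.1, g) hg h0
  subst hg0
  refine Lp.ext ?_
  filter_upwards [h, Lp.coeFn_zero ℝ 2 ((volume : Measure (Eu d)).restrict O),
    Lp.coeFn_zero (Eu d) 2 ((volume : Measure (Eu d)).restrict O)] with x h1 h2 h3
  rw [h1, h2, h3]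
  simp

/-- The operator `B u = ⟨b, ∇u⟩` in `L²(O)`. Its domain is `H¹(O)` as soon as `b` is continuous on
`closure O` and `O` is open and bounded, see `transportOperator_domain`. -/
def transportOperator {d : ℕ} (O : Set (Eu d)) (b : Eu d → Eu d) : L2 O →ₗ.[ℝ] L2 O :=
  (transportGraph O b).toLinearPMap

theorem transportOperator_graph {d : ℕ} {O : Set (Eu d)} (hO : IsOpen O) (b : Eu d → Eu d) :
    (transportOperator O b).graph = transportGraph O b :=
  Submodule.toLinearPMap_graph_eq _ (transportGraph_unique hO b)

theorem transportOperator_domain {d : ℕ} {O : Set (Eu d)} (hO : IsOpen O)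
    (hbd : Bornology.IsBounded O) {b : Eu d → Eu d} (hb : ContinuousOn b (closure O)) :
    (transportOperator O b).domain = H1 O := by
  ext u
  rw [mem_H1]
  simp only [transportOperator, Submodule.toLinearPMap_domain, Submodule.mem_map, Prod.exists,
    LinearMap.fst_apply]
  constructor
  · rintro ⟨a, f, ⟨g, hg, -⟩, rfl⟩
    exact ⟨g, hg⟩
  · rintro ⟨g, hg⟩
    obtain ⟨C, hC⟩ := hbd.isCompact_closure.exists_bound_of_continuousOn hb
    have hmeas : AEStronglyMeasurable b ((volume : Measure (Eu d)).restrict O) :=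
      (hb.mono subset_closure).aestronglyMeasurable hO.measurableSet
    have hL : MemLp (fun x => ⟪b x, g x⟫) 2 ((volume : Measure (Eu d)).restrict O) := by
      refine (Lp.memLp g).of_le_mul (c := C) (hmeas.inner (Lp.aestronglyMeasurable g)) ?_
      filter_upwards [ae_restrict_mem hO.measurableSet] with x hx
      exact (norm_inner_le_norm _ _).trans
        (mul_le_mul_of_nonneg_right (hC x (subset_closure hx)) (norm_nonneg _))
    exact ⟨u, hL.toLp _, ⟨g, hg, hL.coeFn_toLp⟩, rfl⟩

/-! ### The Neumann Laplacian -/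

/-- The graph of the Neumann Laplacian: pairs `(u, f)` such that `u ∈ H¹(O)` and
`∫ v f = - ∫ ⟨∇v, ∇u⟩` for all `v ∈ H¹(O)`. Taking test functions for `v` shows that `f` is then
the distributional Laplacian of `u`. -/
def neumannLaplacianGraph {d : ℕ} (O : Set (Eu d)) : Submodule ℝ (L2 O × L2 O) where
  carrier := {p | ∃ g : L2Vec O, HasWeakGradient O p.1 g ∧
    ∀ (v : L2 O) (w : L2Vec O), HasWeakGradient O v w → ⟪v, p.2⟫ = - ⟪w, g⟫}
  zero_mem' := ⟨0, (weakGradientGraph O).zero_mem, by intro v w _; simp⟩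
  add_mem' := by
    rintro p q ⟨g, hg, hp⟩ ⟨k, hk, hq⟩
    refine ⟨g + k, (weakGradientGraph O).add_mem (x := (p.1, g)) (y := (q.1, k)) hg hk, ?_⟩
    intro v w h
    rw [Prod.snd_add, inner_add_right, inner_add_right, hp v w h, hq v w h]
    ring
  smul_mem' := by
    rintro c p ⟨g, hg, hp⟩
    refine ⟨c • g, (weakGradientGraph O).smul_mem (x := (p.1, g)) c hg, ?_⟩
    intro v w h
    rw [Prod.smul_snd, real_inner_smul_right, real_inner_smul_right, hp v w h]
    ring

/-- Test functions have a weak gradient in `L²`. -/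
theorem IsTestFunction.mem_H1 {d : ℕ} {O : Set (Eu d)} {ψ : Eu d → ℝ}
    (h : IsTestFunction O ψ) : h.memLp.toLp ψ ∈ H1 O := by
  rw [NeumannKilling.mem_H1]
  have hc : Continuous (gradient ψ) :=
    (InnerProductSpace.toDual ℝ (Eu d)).symm.continuous.comp
      (h.contDiff.continuous_fderiv (by simp))
  have hcs : HasCompactSupport (gradient ψ) :=
    (h.hasCompactSupport.fderiv (𝕜 := ℝ)).comp_left
      (g := (InnerProductSpace.toDual ℝ (Eu d)).symm) (map_zero _)
  have hL : MemLp (gradient ψ) 2 ((volume : Measure (Eu d)).restrict O) :=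
    hc.memLp_of_hasCompactSupport hcs
  refine ⟨hL.toLp _, ?_⟩
  intro η hη v
  have h1 : (fun x => (h.memLp.toLp ψ) x * fderiv ℝ η x v)
      =ᵐ[(volume : Measure (Eu d)).restrict O] fun x => ψ x * fderiv ℝ η x v := by
    filter_upwards [h.memLp.coeFn_toLp] with x hx
    rw [hx]
  have h2 : (fun x => η x * ⟪(hL.toLp _) x, v⟫)
      =ᵐ[(volume : Measure (Eu d)).restrict O] fun x => fderiv ℝ ψ x v * η x := by
    filter_upwards [hL.coeFn_toLp] with x hx
    rw [hx, gradient, InnerProductSpace.toDual_symm_apply, mul_comm]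
  rw [integral_congr_ae h1, integral_congr_ae h2,
    setIntegral_eq_integral_of_forall_compl_eq_zero, setIntegral_eq_integral_of_forall_compl_eq_zero]
  · have d1 : Differentiable ℝ ψ := h.contDiff.differentiable (by simp)
    have d2 : Differentiable ℝ η := hη.contDiff.differentiable (by simp)
    have c1 : Continuous fun x => fderiv ℝ ψ x v :=
      (h.contDiff.continuous_fderiv (by simp)).clm_apply continuous_const
    have c2 : Continuous fun x => fderiv ℝ η x v :=
      (hη.contDiff.continuous_fderiv (by simp)).clm_apply continuous_const
    refine integral_mul_fderiv_eq_neg_fderiv_mul_of_integrable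
      ?_ ?_ ?_ (fun x _ => d1 x) (fun x _ => d2 x)
    · exact (c1.mul d2.continuous).integrable_of_hasCompactSupport hη.hasCompactSupport.mul_left
    · exact (d1.continuous.mul c2).integrable_of_hasCompactSupport h.hasCompactSupport.mul_right
    · exact (d1.continuous.mul d2.continuous).integrable_of_hasCompactSupport
        h.hasCompactSupport.mul_right
  · intro x hx
    have : η x = 0 := image_eq_zero_of_notMem_tsupport (fun h' => hx (hη.tsupport_subset h'))
    simp [this]
  · intro x hx
    have : ψ x = 0 := image_eq_zero_of_notMem_tsupport (fun h' => hx (h.tsupport_subset h'))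
    simp [this]

theorem neumannLaplacianGraph_unique {d : ℕ} {O : Set (Eu d)} (hO : IsOpen O)
    (p : L2 O × L2 O) (hp : p ∈ neumannLaplacianGraph O) (h0 : p.1 = 0) : p.2 = 0 := by
  obtain ⟨g, hg, h⟩ := hp
  have hg0 : g = 0 := weakGradient_unique hO (p.1, g) hg h0
  subst hg0
  have hint : LocallyIntegrableOn p.2 O (volume : Measure (Eu d)) :=
    locallyIntegrableOn_of_locallyIntegrable_restrict
      ((Lp.memLp p.2).locallyIntegrable (by norm_num))
  have key : ∀ᵐ x ∂(volume : Measure (Eu d)), x ∈ O → p.2 x = 0 := by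
    refine hO.ae_eq_zero_of_integral_contDiff_smul_eq_zero hint ?_
    intro ψ h1 h2 h3
    have hψ : IsTestFunction O ψ := ⟨h1, h2, h3⟩
    obtain ⟨w, hw⟩ := NeumannKilling.mem_H1.1 hψ.mem_H1
    have e := h _ w hw
    rw [inner_zero_right, neg_zero, L2.inner_def] at e
    rw [← setIntegral_eq_integral_of_forall_compl_eq_zero (s := O), ← e]
    · refine integral_congr_ae ?_
      filter_upwards [hψ.memLp.coeFn_toLp] with x hx
      rw [hx]
      simp [mul_comm]
    · intro x hx
      have : ψ x = 0 := image_eq_zero_of_notMem_tsupport (fun h' => hx (h3 h'))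
      simp [this]
  refine Lp.ext ?_
  filter_upwards [(ae_restrict_iff' hO.measurableSet).2 key,
    Lp.coeFn_zero ℝ 2 ((volume : Measure (Eu d)).restrict O)] with x h1 h2
  rw [h1, h2]
  rfl

/-- The Neumann Laplacian `Δ` in `L²(O)`, with its domain. -/
def neumannLaplacian {d : ℕ} (O : Set (Eu d)) : L2 O →ₗ.[ℝ] L2 O :=
  (neumannLaplacianGraph O).toLinearPMap

theorem neumannLaplacian_graph {d : ℕ} {O : Set (Eu d)} (hO : IsOpen O) :
    (neumannLaplacian O).graph = neumannLaplacianGraph O :=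
  Submodule.toLinearPMap_graph_eq _ (neumannLaplacianGraph_unique hO)

/-! ### The conditions of Shigekawa's commutation theorem, and resolvents -/

/-- The subspace `D` of the domain of `A` is a core for `A`: it is dense in the domain with respect
to the graph norm `u ↦ (‖A u‖² + ‖u‖²)^(1/2)`. -/
def IsCore {H : Type*} [NormedAddCommGroup H] [InnerProductSpace ℝ H]
    (A : H →ₗ.[ℝ] H) (D : Submodule ℝ H) : Prop :=
  D ≤ A.domain ∧ ∀ u : A.domain, ∀ ε > (0 : ℝ), ∃ v : A.domain, (v : H) ∈ D ∧
    ‖A (u - v)‖ ^ 2 + ‖(u : H) - (v : H)‖ ^ 2 < ε ^ 2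

/-- The conditions of Shigekawa's commutation theorem for the operators `A` (the Laplacian) and `B`
and the subspace `D` of the domain of `A`; `B.adjoint` is the Hilbert space adjoint. -/
structure ShigekawaConditions {H : Type*} [NormedAddCommGroup H] [InnerProductSpace ℝ H]
    [CompleteSpace H] (A B : H →ₗ.[ℝ] H) (D : Submodule ℝ H) : Prop where
  subset_domain : D ≤ A.domain
  domain_le : A.domain ≤ B.domain
  domain_le_adjoint : A.domain ≤ B.adjoint.domain
  map_mem : ∀ u (hu : u ∈ D), A ⟨u, subset_domain hu⟩ ∈ B.domain
  mem_domain : ∀ u (hu : u ∈ D), B ⟨u, domain_le (subset_domain hu)⟩ ∈ A.domain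
  core : IsCore A D
  commute : ∀ u (hu : u ∈ D),
    B ⟨A ⟨u, subset_domain hu⟩, map_mem u hu⟩
      = A ⟨B ⟨u, domain_le (subset_domain hu)⟩, mem_domain u hu⟩

/-- The bounded operator `J` is the resolvent `(Id - δ A)⁻¹`, that is, `J` maps into the domain of
`A` and is a two-sided inverse of `Id - δ A : dom A → H`. -/
structure IsResolvent {H : Type*} [NormedAddCommGroup H] [InnerProductSpace ℝ H]
    (A : H →ₗ.[ℝ] H) (δ : ℝ) (J : H →L[ℝ] H) : Prop where
  mem_domain : ∀ f, J f ∈ A.domain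
  right_inv : ∀ f, J f - δ • A ⟨J f, mem_domain f⟩ = f
  left_inv : ∀ u : A.domain, J ((u : H) - δ • A u) = u

end NeumannKilling

end

open NeumannKilling

noncomputable section

namespace NeumannKilling

/-! ### Defining functions and the geometry of the boundary -/

section Boundary

variable {d : ℕ} {O : Set (Eu d)} {x : Eu d} {φ φ' : Eu d → ℝ}

/-! The hypotheses force each `b i` to be an infinitesimal rotation that preserves `O`, and the
Neumann Laplacian commutes with rotations preserving its domain.

Rigidity. Put F = (Db)ᵀb + (Db)b. Since div b = 0 and ⟨Δb, b⟩ = 0, div F = ½|Db + (Db)ᵀ|², while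
(iv) says that F is tangential. The divergence theorem makes Db skew (`inner_fderiv_self_eq_zero`).
A field with skew derivative on a connected open set is affine, b = Ax + c. Tangency and boundedness
make its mean over `O` vanish, so b = A(x - p) with p the barycenter
(`NoiseAssumption.exists_rotation`). The divergence theorem is needed for tangential fields only and
is obtained without surface measure, by cutting off along a defining function
(`setIntegral_dvg_eq_zero`).

Flow. The rotations Φ_t(x) = p + exp(tA)(x - p) leave integrals of test functions over `O`
unchanged, hence map `O` onto itself (`preimage_rigid_rot`). Composition with Φ_t is then an
isometric group U_t on L² that preserves the Neumann form, so it commutes with the resolvent J. Its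
weak derivative at t = 0 on H¹ is B (`hasDerivAt_inner_rotPull`).

Commutation. Differentiating ⟨v, U_t J u⟩ = ⟨J v, U_t u⟩ at t = 0 gives BJ = JB on dom B
(`resolvent_transport_comm`), with no boundary regularity of solutions. The core conditions are
deduced from this, not conversely: 𝒟 = J₁(dom B) works because ΔJ₁ = J₁ - Id and B is skew-symmetric
and densely defined (`exists_shigekawaConditions`). -/

theorem inner_gradient_eq_fderiv (φ : Eu d → ℝ) (x v : Eu d) :
    ⟪gradient φ x, v⟫ = fderiv ℝ φ x v := by
  rw [gradient, InnerProductSpace.toDual_symm_apply]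

theorem IsDefiningFunctionAt.fderiv_ne_zero (h : IsDefiningFunctionAt O x φ) :
    fderiv ℝ φ x ≠ 0 := by
  intro h0
  apply h.gradient_ne_zero
  rw [gradient, h0, map_zero]

theorem IsDefiningFunctionAt.differentiable (h : IsDefiningFunctionAt O x φ) :
    Differentiable ℝ φ :=
  h.contDiff.differentiable (by simp)

theorem IsDefiningFunctionAt.apply_eq_zero (h : IsDefiningFunctionAt O x φ) (hO : IsOpen O)
    (hx : x ∈ frontier O) : φ x = 0 := by
  have hxO : x ∉ O := by
    have := hx.2
    rwa [hO.interior_eq] at this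
  have h1 : ¬ φ x < 0 := fun hlt => hxO (h.eventually_mem_iff.self_of_nhds.2 hlt)
  have h2 : φ x ≤ 0 := by
    by_contra! hpos
    have hev : ∀ᶠ y in 𝓝 x, 0 < φ y :=
      h.contDiff.continuous.continuousAt.eventually_const_lt hpos
    have hfr := mem_closure_iff_frequently.1 hx.1
    obtain ⟨y, hyO, hy1, hy2⟩ := (hfr.and_eventually (hev.and h.eventually_mem_iff)).exists
    linarith [hy2.1 hyO]
  exact le_antisymm h2 (not_lt.1 h1)

theorem eventually_neg_of_fderiv_neg (hφ : DifferentiableAt ℝ φ x) (h0 : φ x = 0) {v : Eu d}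
    (hv : fderiv ℝ φ x v < 0) : ∀ᶠ t in 𝓝[>] (0 : ℝ), φ (x + t • v) < 0 := by
  have h1 : HasDerivAt (fun t : ℝ => φ (x + t • v)) (fderiv ℝ φ x v) 0 := by
    have h2 : HasDerivAt (fun t : ℝ => x + t • v) v 0 := by
      simpa using ((hasDerivAt_id (0 : ℝ)).smul_const v).const_add x
    have h3 : HasFDerivAt φ (fderiv ℝ φ x) (x + (0 : ℝ) • v) := by simpa using hφ.hasFDerivAt
    exact h3.comp_hasDerivAt (0 : ℝ) h2
  have h4 := (hasDerivAt_iff_tendsto_slope.1 h1).eventually_lt_const hv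
  have h5 : 𝓝[>] (0 : ℝ) ≤ 𝓝[≠] 0 := nhdsWithin_mono _ (fun t ht => ne_of_gt ht)
  filter_upwards [h5 h4, self_mem_nhdsWithin] with t ht ht0
  have ht0' : (0 : ℝ) < t := ht0
  rw [slope_def_field] at ht
  simp only [zero_smul, add_zero, h0, sub_zero] at ht
  by_contra! hge
  exact absurd ht (not_lt.2 (div_nonneg hge ht0'.le))

theorem tendsto_add_smul_nhdsGT (x v : Eu d) :
    Tendsto (fun t : ℝ => x + t • v) (𝓝[>] 0) (𝓝 x) := by
  have : Tendsto (fun t : ℝ => x + t • v) (𝓝 0) (𝓝 (x + (0 : ℝ) • v)) :=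
    (by fun_prop : Continuous fun t : ℝ => x + t • v).tendsto 0
  rw [zero_smul, add_zero] at this
  exact this.mono_left nhdsWithin_le_nhds

theorem IsDefiningFunctionAt.eventually_mem (h : IsDefiningFunctionAt O x φ) (hO : IsOpen O)
    (hx : x ∈ frontier O) {v : Eu d} (hv : fderiv ℝ φ x v < 0) :
    ∀ᶠ t in 𝓝[>] (0 : ℝ), x + t • v ∈ O := by
  filter_upwards [eventually_neg_of_fderiv_neg (h.differentiable x) (h.apply_eq_zero hO hx) hv,
    (tendsto_add_smul_nhdsGT x v).eventually h.eventually_mem_iff] with t h1 h2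
  exact h2.2 h1

theorem IsDefiningFunctionAt.eventually_notMem_closure (h : IsDefiningFunctionAt O x φ)
    (hO : IsOpen O) (hx : x ∈ frontier O) {v : Eu d} (hv : 0 < fderiv ℝ φ x v) :
    ∀ᶠ t in 𝓝[>] (0 : ℝ), x + t • v ∉ closure O := by
  have hd : fderiv ℝ (fun y => - φ y) x v < 0 := by
    rw [fderiv_fun_neg]
    simpa using hv
  filter_upwards [eventually_neg_of_fderiv_neg (h.differentiable x).fun_neg
      (by simp [h.apply_eq_zero hO hx]) hd,
    (tendsto_add_smul_nhdsGT x v).eventually h.eventually_mem_iff.eventually_nhds] with t h1 h2 h3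
  obtain ⟨y, hyO, hy1, hy2⟩ := ((mem_closure_iff_frequently.1 h3).and_eventually
    ((h.contDiff.continuous.continuousAt.eventually_const_lt
      (show (0 : ℝ) < φ (x + t • v) by linarith)).and h2)).exists
  linarith [hy2.1 hyO]

/-- The tangent hyperplane does not depend on the defining function. -/
theorem IsDefiningFunctionAt.fderiv_eq_zero_of_fderiv_eq_zero (h : IsDefiningFunctionAt O x φ)
    (h' : IsDefiningFunctionAt O x φ') (hO : IsOpen O) (hx : x ∈ frontier O) {w : Eu d}
    (hw : fderiv ℝ φ' x w = 0) : fderiv ℝ φ x w = 0 := by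
  -- Tilt w slightly in a direction in which φ' decreases: the tilted ray enters `O` according to φ'
  -- but leaves `closure O` according to φ.
  have key : ∀ w : Eu d, fderiv ℝ φ' x w = 0 → ¬ 0 < fderiv ℝ φ x w := by
    intro w hw hpos
    obtain ⟨v, hv⟩ : ∃ v, fderiv ℝ φ' x v < 0 := by
      obtain ⟨v, hv⟩ : ∃ v, fderiv ℝ φ' x v ≠ 0 := by
        by_contra! hcon
        exact h'.fderiv_ne_zero (ContinuousLinearMap.ext hcon)
      rcases lt_or_gt_of_ne hv with hv | hv
      · exact ⟨v, hv⟩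
      · exact ⟨-v, by simpa using hv⟩
    have hc : ∀ᶠ s in 𝓝[>] (0 : ℝ), 0 < fderiv ℝ φ x (w + s • v) :=
      (tendsto_add_smul_nhdsGT w v).eventually
        ((fderiv ℝ φ x).continuous.continuousAt.eventually_const_lt hpos)
    obtain ⟨s, hs, hs0⟩ := (hc.and self_mem_nhdsWithin).exists
    have hneg : fderiv ℝ φ' x (w + s • v) < 0 := by
      rw [map_add, hw, map_smul, zero_add, smul_eq_mul]
      exact mul_neg_of_pos_of_neg hs0 hv
    obtain ⟨t, ht1, ht2⟩ := ((h'.eventually_mem hO hx hneg).and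
      (h.eventually_notMem_closure hO hx hs)).exists
    exact ht2 (subset_closure ht1)
  refine le_antisymm (not_lt.1 (key w hw)) ?_
  have := not_lt.1 (key (-w) (by simp [hw]))
  simpa using this

/-- At a boundary point the tangent cone contains the open half-space {dφ < 0}, which spans. This
gives derivatives within `closure O` their usual calculus. -/
theorem HasC2Boundary.uniqueDiffOn_closure (hO : IsOpen O) (hb : HasC2Boundary O) :
    UniqueDiffOn ℝ (closure O) := by
  intro x hx
  rw [uniqueDiffWithinAt_closure]
  by_cases hxO : x ∈ O
  · exact hO.uniqueDiffWithinAt hxO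
  have hxf : x ∈ frontier O := ⟨hx, by rwa [hO.interior_eq]⟩
  obtain ⟨φ, hφ⟩ := hb x hxf
  have hcone : ∀ v, fderiv ℝ φ x v < 0 → v ∈ tangentConeAt ℝ O x := by
    intro v hv
    refine mem_tangentConeAt_of_add_smul_mem (l := 𝓝[>] (0 : ℝ)) (c := id) ?_ ?_
    · exact nhdsWithin_mono _ (fun t ht => ne_of_gt ht)
    · exact hφ.eventually_mem hO hxf hv
  refine ⟨?_, hx⟩
  obtain ⟨v, hv⟩ : ∃ v, fderiv ℝ φ x v ≠ 0 := by
    by_contra! hcon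
    exact hφ.fderiv_ne_zero (ContinuousLinearMap.ext hcon)
  have htop : Submodule.span ℝ (tangentConeAt ℝ O x) = ⊤ := by
    rw [Submodule.eq_top_iff']
    intro u
    -- Chosen so that both s • v and u + s • v lie in the half-space; their difference is u.
    set s : ℝ := -(|fderiv ℝ φ x u| + 1) / fderiv ℝ φ x v with hs
    have h1 : fderiv ℝ φ x (s • v) = -(|fderiv ℝ φ x u| + 1) := by
      rw [map_smul, smul_eq_mul, hs, div_mul_cancel₀ _ hv]
    have h2 : s • v ∈ tangentConeAt ℝ O x := hcone _ (by rw [h1]; linarith [abs_nonneg (fderiv ℝ φ x u)])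
    have h3 : u + s • v ∈ tangentConeAt ℝ O x :=
      hcone _ (by rw [map_add, h1]; linarith [le_abs_self (fderiv ℝ φ x u)])
    have := Submodule.sub_mem _ (Submodule.subset_span (R := ℝ) h3) (Submodule.subset_span h2)
    simpa using this
  rw [htop]
  simp

/-- Arbitrarily close to a boundary point there are points outside `closure O`, so `O` has no slits
or punctures. It is used to pass from Φ_t(O) ⊆ `closure O` to Φ_t(O) ⊆ `O`. -/
theorem HasC2Boundary.interior_closure_subset (hO : IsOpen O) (hb : HasC2Boundary O) :
    interior (closure O) ⊆ O := by
  intro x hx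
  by_contra hxO
  have hxf : x ∈ frontier O := ⟨interior_subset hx, by rwa [hO.interior_eq]⟩
  obtain ⟨φ, hφ⟩ := hb x hxf
  obtain ⟨v, hv⟩ : ∃ v, 0 < fderiv ℝ φ x v := by
    obtain ⟨v, hv⟩ : ∃ v, fderiv ℝ φ x v ≠ 0 := by
      by_contra! hcon
      exact hφ.fderiv_ne_zero (ContinuousLinearMap.ext hcon)
    rcases lt_or_gt_of_ne hv with hv | hv
    · exact ⟨-v, by simpa using hv⟩
    · exact ⟨v, hv⟩
  obtain ⟨t, ht1, ht2⟩ := ((hφ.eventually_notMem_closure hO hxf hv).and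
    ((tendsto_add_smul_nhdsGT x v).eventually (mem_interior_iff_mem_nhds.1 hx))).exists
  exact ht1 ht2

/-- A vector field is tangential to the boundary of `O`. -/
def IsTangential (O : Set (Eu d)) (F : Eu d → Eu d) : Prop :=
  ∀ x ∈ frontier O, ∀ φ : Eu d → ℝ, IsDefiningFunctionAt O x φ → fderiv ℝ φ x (F x) = 0

theorem isTangential_of_inner_normal {ν F : Eu d → Eu d} (hO : IsOpen O)
    (hν : ∀ x ∈ frontier O, IsOuterUnitNormalAt O x (ν x))
    (hF : ∀ x ∈ frontier O, ⟪F x, ν x⟫ = 0) : IsTangential O F := by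
  intro x hx φ hφ
  obtain ⟨φ', hφ', hn⟩ := hν x hx
  refine hφ.fderiv_eq_zero_of_fderiv_eq_zero hφ' hO hx ?_
  have h1 := hF x hx
  rw [hn, inner_smul_right, real_inner_comm, inner_gradient_eq_fderiv] at h1
  exact (mul_eq_zero.1 h1).resolve_left (inv_ne_zero (norm_ne_zero_iff.2 hφ'.gradient_ne_zero))

end Boundary

/-! ### The divergence theorem for tangential vector fields -/

section Divergence

variable {d : ℕ} {O : Set (Eu d)}

/-- The divergence of a vector field in the interior of its domain. -/
def dvg (F : Eu d → Eu d) (x : Eu d) : ℝ :=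
  ∑ k : Fin d, (fderiv ℝ F x (EuclideanSpace.single k 1)) k

theorem continuous_mul_of_tsupport_subset (hO : IsOpen O) {η G : Eu d → ℝ} (hη : Continuous η)
    (hs : tsupport η ⊆ O) (hG : ContinuousOn G O) : Continuous fun x => η x * G x := by
  refine continuous_of_tsupport fun x hx => ?_
  have hxO : x ∈ O := hs ((tsupport_mul_subset_left : tsupport (η * G) ⊆ tsupport η) hx)
  exact hη.continuousAt.mul (hG.continuousAt (hO.mem_nhds hxO))

theorem integrable_mul_of_tsupport_subset (hO : IsOpen O) {η G : Eu d → ℝ} (hη : Continuous η)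
    (hc : HasCompactSupport η) (hs : tsupport η ⊆ O) (hG : ContinuousOn G O) :
    Integrable (fun x => η x * G x) :=
  (continuous_mul_of_tsupport_subset hO hη hs hG).integrable_of_hasCompactSupport hc.mul_right

theorem sum_smul_single (v : Eu d) : ∑ k, v k • EuclideanSpace.single k (1 : ℝ) = v := by
  simpa using (EuclideanSpace.basisFun (Fin d) ℝ).sum_repr v

theorem clm_apply_eq_sum {W : Type*} [NormedAddCommGroup W] [NormedSpace ℝ W]
    (L : Eu d →L[ℝ] W) (v : Eu d) :
    L v = ∑ k, v k • L (EuclideanSpace.single k 1) := by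
  conv_lhs => rw [← sum_smul_single v]
  rw [map_sum]
  simp only [map_smul]

theorem continuousOn_dvg (hO : IsOpen O) {F : Eu d → Eu d} (hF : ContDiffOn ℝ 1 F O) :
    ContinuousOn (dvg F) O := by
  have h := hF.continuousOn_fderiv_of_isOpen hO le_rfl
  unfold dvg
  refine continuousOn_finsetSum _ fun k _ => ?_
  exact (EuclideanSpace.proj (𝕜 := ℝ) k).continuous.comp_continuousOn (h.clm_apply continuousOn_const)

theorem fderiv_coord {F : Eu d → Eu d} {x : Eu d} (hF : DifferentiableAt ℝ F x) (k : Fin d)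
    (v : Eu d) : fderiv ℝ (fun y => F y k) x v = (fderiv ℝ F x v) k := by
  have := ((EuclideanSpace.proj (𝕜 := ℝ) k).hasFDerivAt (x := F x)).comp x hF.hasFDerivAt
  rw [show (fun y => F y k) = (EuclideanSpace.proj (𝕜 := ℝ) k) ∘ F from rfl, this.fderiv]
  rfl

/-- The integrand is div(ηF), and ηF has compact support in `O`: integrate by parts in each
coordinate. -/
theorem integral_mul_dvg_of_tsupport_subset (hO : IsOpen O) {η : Eu d → ℝ} {F : Eu d → Eu d}
    (hη : ContDiff ℝ 1 η) (hc : HasCompactSupport η) (hs : tsupport η ⊆ O)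
    (hF : ContDiffOn ℝ 1 F O) :
    ∫ x in O, (η x * dvg F x + fderiv ℝ η x (F x)) = 0 := by
  have hcd : ContinuousOn (fderiv ℝ F) O := hF.continuousOn_fderiv_of_isOpen hO le_rfl
  have hFc : ∀ k, ContinuousOn (fun y => F y k) O := fun k =>
    (EuclideanSpace.proj (𝕜 := ℝ) k).continuous.comp_continuousOn hF.continuousOn
  have hdiff : ∀ x ∈ O, DifferentiableAt ℝ F x := fun x hx =>
    (hF.differentiableOn (by simp)).differentiableAt (hO.mem_nhds hx)
  have hdη : ∀ v, Continuous fun x => fderiv ℝ η x v := fun v =>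
    (hη.continuous_fderiv (by simp)).clm_apply continuous_const
  have hcη : ∀ v, HasCompactSupport fun x => fderiv ℝ η x v := fun v =>
    hc.fderiv_apply (𝕜 := ℝ) v
  have hsη : ∀ v, tsupport (fun x => fderiv ℝ η x v) ⊆ O := fun v =>
    (tsupport_fderiv_apply_subset ℝ v).trans hs
  have i1 : ∀ k, Integrable (fun x => η x * (fderiv ℝ F x (EuclideanSpace.single k 1)) k) :=
    fun k => integrable_mul_of_tsupport_subset hO hη.continuous hc hs
      ((EuclideanSpace.proj (𝕜 := ℝ) k).continuous.comp_continuousOn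
        (hcd.clm_apply continuousOn_const))
  have i2 : ∀ k, Integrable (fun x => fderiv ℝ η x (EuclideanSpace.single k 1) * F x k) :=
    fun k => integrable_mul_of_tsupport_subset hO (hdη _) (hcη _) (hsη _) (hFc k)
  have key : ∀ k, ∫ x, (η x * (fderiv ℝ F x (EuclideanSpace.single k 1)) k
      + fderiv ℝ η x (EuclideanSpace.single k 1) * F x k) = 0 := by
    intro k
    have hpt : ∀ x, η x * (fderiv ℝ F x (EuclideanSpace.single k 1)) k
        = η x * fderiv ℝ (fun y => F y k) x (EuclideanSpace.single k 1) := by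
      intro x
      by_cases hx : x ∈ tsupport η
      · rw [fderiv_coord (hdiff x (hs hx))]
      · rw [image_eq_zero_of_notMem_tsupport hx, zero_mul, zero_mul]
    have i1' := i1 k
    rw [integral_add i1' (i2 k)]
    simp_rw [hpt] at i1' ⊢
    rw [integral_mul_fderiv_eq_neg_fderiv_mul_of_integrable (i2 k) i1'
      (integrable_mul_of_tsupport_subset hO hη.continuous hc hs (hFc k))
      (fun x _ => hη.differentiable (by simp) x)
      (fun x hx => (EuclideanSpace.proj (𝕜 := ℝ) k).differentiableAt.comp x (hdiff x (hs hx)))]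
    ring
  rw [setIntegral_eq_integral_of_forall_compl_eq_zero]
  · have : ∀ x, η x * dvg F x + fderiv ℝ η x (F x)
        = ∑ k, (η x * (fderiv ℝ F x (EuclideanSpace.single k 1)) k
          + fderiv ℝ η x (EuclideanSpace.single k 1) * F x k) := by
      intro x
      rw [clm_apply_eq_sum (fderiv ℝ η x) (F x), dvg, Finset.mul_sum, ← Finset.sum_add_distrib]
      refine Finset.sum_congr rfl fun k _ => ?_
      rw [smul_eq_mul, mul_comm (F x k)]
    simp_rw [this]
    rw [integral_finsetSum _ fun k _ => by exact (i1 k).add (i2 k)]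
    exact Finset.sum_eq_zero fun k _ => key k
  · intro x hx
    have h1 : x ∉ tsupport η := fun h => hx (hs h)
    rw [image_eq_zero_of_notMem_tsupport h1, fderiv_of_notMem_tsupport ℝ h1]
    simp

/-! ### Boundary layer cutoffs and the flux through the layer. -/

theorem abs_smoothTransition_le_one (s : ℝ) : |Real.smoothTransition s| ≤ 1 := by
  rw [abs_of_nonneg (Real.smoothTransition.nonneg s)]
  exact Real.smoothTransition.le_one s

theorem deriv_smoothTransition_of_gt {s : ℝ} (hs : 1 < s) :
    deriv Real.smoothTransition s = 0 := by
  have : Real.smoothTransition =ᶠ[𝓝 s] fun _ => 1 := by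
    filter_upwards [Ioi_mem_nhds hs] with y hy
    exact Real.smoothTransition.one_of_one_le (le_of_lt hy)
  rw [this.deriv_eq, deriv_const]

/-- A cutoff function which vanishes near `{φ ≥ 0}` and tends to `1` on `{φ < 0}`. -/
def layerCutoff (φ : Eu d → ℝ) (n : ℕ) (x : Eu d) : ℝ :=
  Real.smoothTransition (-((n : ℝ) + 1) * φ x - 1)

/-- The density with which `layerCutoff φ n` decreases along `φ`. -/
def layerDensity (φ : Eu d → ℝ) (n : ℕ) (x : Eu d) : ℝ :=
  deriv Real.smoothTransition (-((n : ℝ) + 1) * φ x - 1) * ((n : ℝ) + 1)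

theorem layerDensity_nonneg (φ : Eu d → ℝ) (n : ℕ) (x : Eu d) : 0 ≤ layerDensity φ n x :=
  mul_nonneg Real.smoothTransition.monotone.deriv_nonneg (by positivity)

theorem continuous_layerDensity {φ : Eu d → ℝ} (hφ : Continuous φ) (n : ℕ) :
    Continuous (layerDensity φ n) := by
  have h : Continuous (deriv Real.smoothTransition) :=
    (Real.smoothTransition.contDiff (n := 1)).continuous_deriv le_rfl
  unfold layerDensity
  fun_prop

theorem contDiff_layerCutoff {φ : Eu d → ℝ} (hφ : ContDiff ℝ 2 φ) (n : ℕ) :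
    ContDiff ℝ 2 (layerCutoff φ n) := by
  unfold layerCutoff
  exact (Real.smoothTransition.contDiff (n := 2)).comp
    ((contDiff_const.mul hφ).sub contDiff_const)

theorem fderiv_layerCutoff {φ : Eu d → ℝ} {x : Eu d} (hφ : DifferentiableAt ℝ φ x) (n : ℕ)
    (v : Eu d) :
    fderiv ℝ (layerCutoff φ n) x v = - (layerDensity φ n x * fderiv ℝ φ x v) := by
  have h1 : HasDerivAt Real.smoothTransition
      (deriv Real.smoothTransition (-((n : ℝ) + 1) * φ x - 1)) (-((n : ℝ) + 1) * φ x - 1) :=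
    ((Real.smoothTransition.contDiff (n := 1)).differentiable (by simp) _).hasDerivAt
  have h2 : HasFDerivAt (fun y => -((n : ℝ) + 1) * φ y - 1) ((-((n : ℝ) + 1)) • fderiv ℝ φ x) x :=
    (hφ.hasFDerivAt.const_mul _).sub_const 1
  have h3 := h1.comp_hasFDerivAt x h2
  rw [show layerCutoff φ n = Real.smoothTransition ∘ fun y => -((n : ℝ) + 1) * φ y - 1 from rfl,
    h3.fderiv]
  simp only [layerDensity, _root_.smul_apply, smul_eq_mul]
  ring

theorem tsupport_mul_layerCutoff_subset {φ : Eu d → ℝ} (hφ : Continuous φ) (n : ℕ)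
    (θ : Eu d → ℝ) :
    tsupport (fun x => θ x * layerCutoff φ n x) ⊆ tsupport θ ∩ {x | φ x < 0} := by
  -- The shift by -1 in the cutoff confines the support to the closed set {φ ≤ -1/(n+1)}, strictly
  -- inside {φ < 0}.
  have hsub : tsupport (fun x => θ x * layerCutoff φ n x)
      ⊆ tsupport θ ∩ {x | -((n : ℝ) + 1) * φ x - 1 ≥ 0} := by
    refine closure_minimal ?_ ((isClosed_tsupport θ).inter
      (isClosed_le continuous_const (by fun_prop)))
    intro x hx
    have hx' : θ x * layerCutoff φ n x ≠ 0 := hx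
    refine ⟨subset_tsupport _ (left_ne_zero_of_mul hx'), ?_⟩
    have h2 := right_ne_zero_of_mul hx'
    by_contra hlt
    exact h2 (Real.smoothTransition.zero_of_nonpos (le_of_lt (not_le.1 hlt)))
  refine hsub.trans (inter_subset_inter_right _ fun x hx => ?_)
  have hx' : -((n : ℝ) + 1) * φ x - 1 ≥ 0 := hx
  have hn : (0 : ℝ) < (n : ℝ) + 1 := by positivity
  change φ x < 0
  by_contra! h
  nlinarith [mul_nonneg hn.le h]

theorem tendsto_layerCutoff {φ : Eu d → ℝ} {x : Eu d} (hx : φ x < 0) :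
    Tendsto (fun n => layerCutoff φ n x) atTop (𝓝 1) := by
  have h : Tendsto (fun n : ℕ => -((n : ℝ) + 1) * φ x - 1) atTop atTop := by
    have h1 : Tendsto (fun n : ℕ => ((n : ℝ) + 1) * (- φ x)) atTop atTop :=
      (tendsto_atTop_add_const_right _ 1 tendsto_natCast_atTop_atTop).atTop_mul_const (by linarith)
    have h2 := tendsto_atTop_add_const_right _ (-1 : ℝ) h1
    refine h2.congr fun n => by ring
  refine tendsto_const_nhds.congr' ?_
  filter_upwards [h.eventually_ge_atTop 1] with n hn
  exact (Real.smoothTransition.one_of_one_le hn).symm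

/-- The function θ times the cutoff has compact support in `O`, so the interior formula applies; the
derivative of the cutoff produces the layer term. It is used both for F and for ∇φ. -/
theorem setIntegral_layer_eq (hO : IsOpen O) {U : Set (Eu d)} {φ θ : Eu d → ℝ}
    (hφ : ContDiff ℝ 2 φ) (hU : ∀ y ∈ U, (y ∈ O ↔ φ y < 0))
    (hθ : ContDiff ℝ ∞ θ) (hc : HasCompactSupport θ) (hs : tsupport θ ⊆ U)
    {F : Eu d → Eu d} (hFc : ContinuousOn F (closure O)) (hF : ContDiffOn ℝ 1 F O)
    (hbd : Bornology.IsBounded O)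
    (hdiv : IntegrableOn (dvg F) O) (n : ℕ) :
    ∫ x in O, θ x * layerDensity φ n x * fderiv ℝ φ x (F x)
      = ∫ x in O, layerCutoff φ n x * (θ x * dvg F x + fderiv ℝ θ x (F x)) ∧
    IntegrableOn (fun x => θ x * layerDensity φ n x * fderiv ℝ φ x (F x)) O ∧
    IntegrableOn (fun x => θ x * dvg F x + fderiv ℝ θ x (F x)) O := by
  have hcχ := contDiff_layerCutoff hφ n
  have hsub := tsupport_mul_layerCutoff_subset hφ.continuous n θ
  have h0 := integral_mul_dvg_of_tsupport_subset hO (η := fun x => θ x * layerCutoff φ n x)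
    ((hθ.of_le (by simp)).mul (hcχ.of_le (by norm_num))) hc.mul_right
    (fun x hx => (hU x (hs (hsub hx).1)).2 (hsub hx).2) hF
  have hK : IsCompact (closure O) := hbd.isCompact_closure
  have hcont : ∀ G : Eu d → ℝ, ContinuousOn G (closure O) → IntegrableOn G O := fun G hG =>
    (hG.integrableOn_compact hK).mono_set subset_closure
  have i1 : IntegrableOn (fun x => θ x * layerDensity φ n x * fderiv ℝ φ x (F x)) O :=
    hcont _ ((hθ.continuous.mul (continuous_layerDensity hφ.continuous n)).continuousOn.mul
      ((hφ.continuous_fderiv (by simp)).continuousOn.clm_apply hFc))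
  have i2 : IntegrableOn (fun x => fderiv ℝ θ x (F x)) O :=
    hcont _ ((hθ.continuous_fderiv (by simp)).continuousOn.clm_apply hFc)
  have i3 : IntegrableOn (fun x => θ x * dvg F x) O := by
    obtain ⟨C, hC⟩ := hc.exists_bound_of_continuous hθ.continuous
    exact hdiv.bdd_mul hθ.continuous.aestronglyMeasurable (ae_of_all _ hC)
  refine ⟨?_, i1, i3.add i2⟩
  have i4 : IntegrableOn (fun x => layerCutoff φ n x * (θ x * dvg F x + fderiv ℝ θ x (F x))) O :=
    (i3.add i2).bdd_mul hcχ.continuous.aestronglyMeasurable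
      (ae_of_all _ fun x => abs_smoothTransition_le_one _)
  have hpt : ∀ x, θ x * layerCutoff φ n x * dvg F x
      + fderiv ℝ (fun x => θ x * layerCutoff φ n x) x (F x)
      = layerCutoff φ n x * (θ x * dvg F x + fderiv ℝ θ x (F x))
        - θ x * layerDensity φ n x * fderiv ℝ φ x (F x) := by
    intro x
    rw [fderiv_fun_mul (hθ.differentiable (by simp) x) (hcχ.differentiable (by simp) x)]
    simp only [_root_.add_apply, _root_.smul_apply, smul_eq_mul,
      fderiv_layerCutoff (hφ.differentiable (by simp) x)]
    ring
  simp_rw [hpt] at h0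
  rw [integral_sub i4 i1] at h0
  linarith

theorem contDiff_gradient {φ : Eu d → ℝ} (hφ : ContDiff ℝ 2 φ) : ContDiff ℝ 1 (gradient φ) :=
  (InnerProductSpace.toDual ℝ (Eu d)).symm.toContinuousLinearEquiv.contDiff.comp
    (hφ.fderiv_right (m := 1) (by norm_num))

theorem fderiv_gradient_self (φ : Eu d → ℝ) (x : Eu d) :
    fderiv ℝ φ x (gradient φ x) = ‖gradient φ x‖ ^ 2 := by
  rw [← inner_gradient_eq_fderiv, real_inner_self_eq_norm_sq]

/-- By tangency, the compact set where |dφ(F)| ≥ κ|∇φ|² does not meet {φ ≥ 0}, so φ ≤ -m there for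
some m > 0. The layer eventually lies closer to the boundary than that. -/
theorem eventually_layer_bound {U : Set (Eu d)} {φ θ : Eu d → ℝ}
    (hφ : ContDiff ℝ 2 φ) (hg : ∀ y ∈ U, gradient φ y ≠ 0)
    (hc : HasCompactSupport θ) (hs : tsupport θ ⊆ U)
    {F : Eu d → Eu d} (hFc : ContinuousOn F (closure O))
    (htan : ∀ y ∈ U, y ∈ closure O → 0 ≤ φ y → fderiv ℝ φ y (F y) = 0)
    {κ : ℝ} (hκ : 0 < κ) :
    ∀ᶠ n in atTop, ∀ x ∈ O, θ x ≠ 0 → layerDensity φ n x ≠ 0 →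
      |fderiv ℝ φ x (F x)| ≤ κ * ‖gradient φ x‖ ^ 2 := by
  set K : Set (Eu d) := (closure O ∩ tsupport θ) ∩
    {x | κ * ‖gradient φ x‖ ^ 2 ≤ |fderiv ℝ φ x (F x)|} with hKdef
  have hcl : IsClosed (closure O ∩ tsupport θ) := isClosed_closure.inter (isClosed_tsupport _)
  have hKc : IsCompact K := by
    refine (hc.inter_left isClosed_closure).of_isClosed_subset ?_ inter_subset_left
    refine hcl.isClosed_le (f := fun x => κ * ‖gradient φ x‖ ^ 2)
      (g := fun x => |fderiv ℝ φ x (F x)|) ?_ ?_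
    · exact (((contDiff_gradient hφ).continuous.norm.pow 2).const_mul κ).continuousOn
    · exact (((hφ.continuous_fderiv (by simp)).continuousOn.clm_apply hFc).abs).mono
        inter_subset_left
  obtain ⟨m, hm, hmK⟩ : ∃ m > 0, ∀ x ∈ K, φ x ≤ -m := by
    rcases K.eq_empty_or_nonempty with he | hne
    · exact ⟨1, one_pos, by simp [he]⟩
    · obtain ⟨x₀, hx₀, hmax⟩ := hKc.exists_isMaxOn hne hφ.continuous.continuousOn
      refine ⟨-φ x₀, ?_, fun x hx => by simpa using hmax hx⟩
      by_contra! h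
      have h1 := htan x₀ (hs hx₀.1.2) hx₀.1.1 (by linarith)
      have h2 : κ * ‖gradient φ x₀‖ ^ 2 ≤ |fderiv ℝ φ x₀ (F x₀)| := hx₀.2
      rw [h1, abs_zero] at h2
      have := norm_pos_iff.2 (hg x₀ (hs hx₀.1.2))
      have : 0 < κ * ‖gradient φ x₀‖ ^ 2 := by positivity
      linarith
  have hlim : Tendsto (fun n : ℕ => ((n : ℝ) + 1) * m) atTop atTop :=
    (tendsto_atTop_add_const_right _ 1 tendsto_natCast_atTop_atTop).atTop_mul_const hm
  -- The layer density vanishes once -(n+1)φ - 1 > 1, hence the threshold 2.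
  filter_upwards [hlim.eventually_gt_atTop 2] with n hn x hx hθx hdx
  by_contra! hlt
  have hxK : x ∈ K := ⟨⟨subset_closure hx, subset_tsupport _ hθx⟩, hlt.le⟩
  have h1 := hmK x hxK
  apply hdx
  rw [layerDensity, deriv_smoothTransition_of_gt, zero_mul]
  have hn1 : (0 : ℝ) < (n : ℝ) + 1 := by positivity
  nlinarith [mul_le_mul_of_nonneg_left h1 hn1.le]

/-- The layer identity for the field ∇φ bounds the mass ∫ θ · density · |∇φ|² by a constant M
independent of n. For F the layer term is eventually at most κ times this mass, for every κ > 0, so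
it tends to 0 while the other side tends to the desired integral. -/
theorem integral_mul_dvg_near_boundary (hO : IsOpen O) (hbd : Bornology.IsBounded O)
    {U : Set (Eu d)} {φ θ : Eu d → ℝ}
    (hφ : ContDiff ℝ 2 φ) (hU : ∀ y ∈ U, (y ∈ O ↔ φ y < 0)) (hg : ∀ y ∈ U, gradient φ y ≠ 0)
    (hθ : ContDiff ℝ ∞ θ) (hθ0 : ∀ x, 0 ≤ θ x) (hc : HasCompactSupport θ) (hs : tsupport θ ⊆ U)
    {F : Eu d → Eu d} (hFc : ContinuousOn F (closure O)) (hF : ContDiffOn ℝ 1 F O)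
    (hdiv : IntegrableOn (dvg F) O)
    (htan : ∀ y ∈ U, y ∈ closure O → 0 ≤ φ y → fderiv ℝ φ y (F y) = 0) :
    ∫ x in O, (θ x * dvg F x + fderiv ℝ θ x (F x)) = 0 := by
  have hgr := contDiff_gradient hφ
  have hgdiv : IntegrableOn (dvg (gradient φ)) O :=
    (((continuousOn_dvg isOpen_univ hgr.contDiffOn).mono (subset_univ _)).integrableOn_compact
      hbd.isCompact_closure).mono_set subset_closure
  have eG := fun n => setIntegral_layer_eq hO hφ hU hθ hc hs
    hgr.continuous.continuousOn hgr.contDiffOn hbd hgdiv n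
  have eF := fun n => setIntegral_layer_eq hO hφ hU hθ hc hs hFc hF hbd hdiv n
  set M : ℝ := ∫ x in O, |θ x * dvg (gradient φ) x + fderiv ℝ θ x (gradient φ x)| with hM
  have hM0 : 0 ≤ M := integral_nonneg fun x => abs_nonneg _
  have hGle : ∀ n, ∫ x in O, θ x * layerDensity φ n x * ‖gradient φ x‖ ^ 2 ≤ M := by
    intro n
    have h := (eG n).1
    simp only [fderiv_gradient_self] at h
    rw [h]
    refine (le_abs_self _).trans ?_
    rw [← Real.norm_eq_abs]
    refine norm_integral_le_of_norm_le (eG n).2.2.abs (ae_of_all _ fun x => ?_)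
    rw [norm_mul]
    exact mul_le_of_le_one_left (norm_nonneg _) (abs_smoothTransition_le_one _)
  have hlim : Tendsto (fun n => ∫ x in O, layerCutoff φ n x * (θ x * dvg F x + fderiv ℝ θ x (F x)))
      atTop (𝓝 (∫ x in O, (θ x * dvg F x + fderiv ℝ θ x (F x)))) := by
    refine tendsto_integral_of_dominated_convergence
      (fun x => |θ x * dvg F x + fderiv ℝ θ x (F x)|) (fun n => ?_) (eF 0).2.2.abs
      (fun n => ae_of_all _ fun x => ?_) ?_
    · exact (contDiff_layerCutoff hφ n).continuous.aestronglyMeasurable.mul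
        (eF 0).2.2.aestronglyMeasurable
    · rw [norm_mul]
      exact mul_le_of_le_one_left (norm_nonneg _) (abs_smoothTransition_le_one _)
    · filter_upwards [ae_restrict_mem hO.measurableSet] with x hx
      by_cases hxU : x ∈ tsupport θ
      · simpa using (tendsto_layerCutoff ((hU x (hs hxU)).1 hx)).mul_const
          (θ x * dvg F x + fderiv ℝ θ x (F x))
      · simp [image_eq_zero_of_notMem_tsupport hxU, fderiv_of_notMem_tsupport ℝ hxU]
  have hbound : ∀ κ > 0, |∫ x in O, (θ x * dvg F x + fderiv ℝ θ x (F x))| ≤ κ * M := by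
    intro κ hκ
    refine le_of_tendsto hlim.abs ?_
    filter_upwards [eventually_layer_bound hφ hg hc hs hFc htan hκ] with n hn
    rw [← (eF n).1]
    have i1 := (eG n).2.1
    simp only [fderiv_gradient_self] at i1
    calc |∫ x in O, θ x * layerDensity φ n x * fderiv ℝ φ x (F x)|
        ≤ ∫ x in O, κ * (θ x * layerDensity φ n x * ‖gradient φ x‖ ^ 2) := by
          rw [← Real.norm_eq_abs]
          refine norm_integral_le_of_norm_le (i1.const_mul κ) ?_
          filter_upwards [ae_restrict_mem hO.measurableSet] with x hx
          have hnn : 0 ≤ θ x * layerDensity φ n x :=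
            mul_nonneg (hθ0 x) (layerDensity_nonneg φ n x)
          rw [norm_mul, Real.norm_of_nonneg hnn, Real.norm_eq_abs]
          by_cases hz : θ x * layerDensity φ n x = 0
          · simp [hz]
          · have := hn x hx (left_ne_zero_of_mul hz) (right_ne_zero_of_mul hz)
            nlinarith [mul_le_mul_of_nonneg_left this hnn]
      _ = κ * ∫ x in O, θ x * layerDensity φ n x * ‖gradient φ x‖ ^ 2 := integral_const_mul _ _
      _ ≤ κ * M := mul_le_mul_of_nonneg_left (hGle n) hκ.le
  have : |∫ x in O, (θ x * dvg F x + fderiv ℝ θ x (F x))| ≤ 0 := by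
    refine le_of_forall_pos_le_add fun ε hε => ?_
    refine (hbound (ε / (M + 1)) (by positivity)).trans ?_
    rw [zero_add, div_mul_eq_mul_div, div_le_iff₀ (by positivity)]
    nlinarith
  exact abs_nonpos_iff.1 this

/-- The divergence theorem for vector fields which are tangential to the boundary. -/
theorem setIntegral_dvg_eq_zero (hO : IsOpen O) (hbd : Bornology.IsBounded O)
    (hb : HasC2Boundary O) {F : Eu d → Eu d} (hFc : ContinuousOn F (closure O))
    (hF : ContDiffOn ℝ 1 F O) (hdiv : IntegrableOn (dvg F) O) (htan : IsTangential O F) :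
    ∫ x in O, dvg F x = 0 := by
  -- The integral of div(θF) vanishes for nonnegative θ with small support; a partition of unity on
  -- `closure O` then sums these, the derivatives of its members adding up to 0 on `O`.
  have hloc : ∀ x ∈ closure O, ∃ U : Set (Eu d), IsOpen U ∧ x ∈ U ∧ ∀ θ : Eu d → ℝ,
      ContDiff ℝ ∞ θ → (∀ x, 0 ≤ θ x) → HasCompactSupport θ → tsupport θ ⊆ U →
      ∫ x in O, (θ x * dvg F x + fderiv ℝ θ x (F x)) = 0 := by
    intro x hx
    by_cases hxO : x ∈ O
    · exact ⟨O, hO, hxO, fun θ hθ _ hc hs =>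
        integral_mul_dvg_of_tsupport_subset hO (hθ.of_le (by simp)) hc hs hF⟩
    have hxf : x ∈ frontier O := ⟨hx, by rwa [hO.interior_eq]⟩
    obtain ⟨φ, hφ⟩ := hb x hxf
    -- Being a defining function is an open condition in the point, so one φ tests tangency at all
    -- boundary points near x.
    have hev : ∀ᶠ y in 𝓝 x, IsDefiningFunctionAt O y φ := by
      filter_upwards [hφ.eventually_mem_iff.eventually_nhds,
        (contDiff_gradient hφ.contDiff).continuous.continuousAt.eventually_ne
          hφ.gradient_ne_zero] with y h1 h2
      exact ⟨hφ.contDiff, h2, h1⟩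
    obtain ⟨U, hU, hUo, hxU⟩ := eventually_nhds_iff.1 hev
    refine ⟨U, hUo, hxU, fun θ hθ hθ0 hc hs => ?_⟩
    refine integral_mul_dvg_near_boundary hO hbd hφ.contDiff
      (fun y hy => (hU y hy).eventually_mem_iff.self_of_nhds)
      (fun y hy => (hU y hy).gradient_ne_zero) hθ hθ0 hc hs hFc hF hdiv ?_
    intro y hy hyc hy0
    have hyO : y ∉ O := fun h =>
      absurd ((hU y hy).eventually_mem_iff.self_of_nhds.1 h) (not_lt.2 hy0)
    exact htan y ⟨hyc, by rwa [hO.interior_eq]⟩ φ (hU y hy)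
  choose! U hUo hxU hUint using hloc
  obtain ⟨t, ht, hcov⟩ := hbd.isCompact_closure.elim_nhds_subcover U
    fun x hx => (hUo x hx).mem_nhds (hxU x hx)
  obtain ⟨R, hR⟩ := hbd.closure.subset_ball 0
  obtain ⟨f, hf⟩ := SmoothPartitionOfUnity.exists_isSubordinate (modelWithCornersSelf ℝ (Eu d))
    (isClosed_closure (s := O)) (fun i : t => U i ∩ Metric.ball 0 R)
    (fun i => (hUo i (ht i i.2)).inter Metric.isOpen_ball) (by
      intro x hx
      obtain ⟨y, hy, hxy⟩ := mem_iUnion₂.1 (hcov hx)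
      exact mem_iUnion.2 ⟨⟨y, hy⟩, hxy, hR hx⟩)
  have hfs : ∀ i, ContDiff ℝ ∞ (f i) := fun i => (f i).contMDiff.contDiff
  have hfc : ∀ i, HasCompactSupport (f i) := fun i =>
    HasCompactSupport.of_support_subset_isCompact (isCompact_closedBall (0 : Eu d) R)
      ((subset_tsupport _).trans ((hf i).trans
        (inter_subset_right.trans Metric.ball_subset_closedBall)))
  have hsum : ∀ x ∈ O, ∑ i, f i x = 1 := fun x hx => by
    rw [← finsum_eq_sum_of_fintype]
    exact f.sum_eq_one (subset_closure hx)
  have hint : ∀ i, IntegrableOn (fun x => f i x * dvg F x + fderiv ℝ (f i) x (F x)) O := by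
    intro i
    obtain ⟨C, hC⟩ := (hfc i).exists_bound_of_continuous (hfs i).continuous
    refine (hdiv.bdd_mul (hfs i).continuous.aestronglyMeasurable (ae_of_all _ hC)).add ?_
    exact ((((hfs i).continuous_fderiv (by simp)).continuousOn.clm_apply hFc).integrableOn_compact
      hbd.isCompact_closure).mono_set subset_closure
  have h0 : ∀ x ∈ O, dvg F x = ∑ i, (f i x * dvg F x + fderiv ℝ (f i) x (F x)) := by
    intro x hx
    have hd : ∑ i, fderiv ℝ (f i) x (F x) = 0 := by
      have h1 : (fun y => ∑ i, f i y) =ᶠ[𝓝 x] fun _ => 1 := by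
        filter_upwards [hO.mem_nhds hx] with y hy using hsum y hy
      have h2 := h1.fderiv_eq (𝕜 := ℝ)
      rw [fderiv_fun_sum fun i _ => (hfs i).differentiable (by simp) x, fderiv_fun_const] at h2
      simpa using congrArg (fun L => L (F x)) h2
    rw [Finset.sum_add_distrib, hd, ← Finset.sum_mul, hsum x hx, one_mul, add_zero]
  rw [setIntegral_congr_fun hO.measurableSet h0, integral_finsetSum _ fun i _ => hint i]
  exact Finset.sum_eq_zero fun i _ => hUint i (ht i i.2) (f i) (hfs i) (fun x => f.nonneg i x)
    (hfc i) ((hf i).trans inter_subset_left)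

end Divergence

/-! ### Rigidity of the coefficient fields -/

section Rigidity

variable {d : ℕ} {O : Set (Eu d)}

theorem integrableOn_dvg (hO : IsOpen O) (hbd : Bornology.IsBounded O)
    (hb : HasC2Boundary O) {F : Eu d → Eu d} (hF : ContDiffOn ℝ 1 F (closure O)) :
    IntegrableOn (dvg F) O := by
  have h : ContinuousOn (divergence O F) (closure O) := by
    unfold divergence
    refine continuousOn_finsetSum _ fun k _ => ?_
    exact (EuclideanSpace.proj (𝕜 := ℝ) k).continuous.comp_continuousOn
      ((hF.continuousOn_fderivWithin (hb.uniqueDiffOn_closure hO) le_rfl).clm_apply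
        continuousOn_const)
  refine ((h.integrableOn_compact hbd.isCompact_closure).mono_set subset_closure).congr_fun
    (fun x hx => ?_) hO.measurableSet
  simp only [divergence, dvg]
  rw [fderivWithin_of_mem_nhds (mem_of_superset (hO.mem_nhds hx) subset_closure)]

/-- The symmetrized derivative of `b` applied to `b`. -/
def strainField (O : Set (Eu d)) (b : Eu d → Eu d) (x : Eu d) : Eu d :=
  WithLp.toLp 2 fun k => ⟪b x, fderivWithin ℝ b (closure O) x (EuclideanSpace.single k 1)⟫
    + (fderivWithin ℝ b (closure O) x (b x)) k

/-- For v = ν the right side is the expression in (iv); this is how the strain field becomes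
tangential. -/
theorem inner_strainField (b : Eu d → Eu d) (x v : Eu d) :
    ⟪strainField O b x, v⟫ = ⟪fderivWithin ℝ b (closure O) x v, b x⟫
      + ⟪fderivWithin ℝ b (closure O) x (b x), v⟫ := by
  rw [clm_apply_eq_sum (fderivWithin ℝ b (closure O) x) v, sum_inner]
  simp only [strainField, PiLp.inner_apply, RCLike.inner_apply, conj_trivial, inner_smul_left,
    ← Finset.sum_add_distrib]
  refine Finset.sum_congr rfl fun k _ => ?_
  rw [mul_add]
  simp only [mul_comm]

theorem contDiffOn_strainField {b : Eu d → Eu d} (hu : UniqueDiffOn ℝ (closure O))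
    (hb : ContDiffOn ℝ 2 b (closure O)) : ContDiffOn ℝ 1 (strainField O b) (closure O) := by
  have hb1 : ContDiffOn ℝ 1 b (closure O) := hb.of_le (by norm_num)
  have hD : ContDiffOn ℝ 1 (fderivWithin ℝ b (closure O)) (closure O) :=
    hb.fderivWithin hu (by norm_num)
  rw [contDiffOn_euclidean]
  intro k
  refine (hb1.inner ℝ (hD.clm_apply contDiffOn_const)).add ?_
  exact contDiffOn_euclidean.1 (hD.clm_apply hb1) k

/-- The second-order terms are ⟨b, Δb⟩ and, by symmetry of D²b, the derivative of div b along b.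
Both vanish, leaving |Db|² + tr((Db)²). -/
theorem dvg_strainField (hO : IsOpen O) (hu : UniqueDiffOn ℝ (closure O)) {b : Eu d → Eu d}
    (hb : ContDiffOn ℝ 2 b (closure O)) (hdiv : ∀ x ∈ O, dvg b x = 0)
    (hlap : ∀ x ∈ O, ⟪(Δ[closure O] b) x, b x⟫ = 0) {x : Eu d} (hx : x ∈ O) :
    dvg (strainField O b) x = ∑ k, ∑ j,
      ((fderiv ℝ b x (EuclideanSpace.single k 1)) j ^ 2
        + (fderiv ℝ b x (EuclideanSpace.single k 1)) j
          * (fderiv ℝ b x (EuclideanSpace.single j 1)) k) := by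
  have hcl : ∀ y ∈ O, closure O ∈ 𝓝 y := fun y hy =>
    mem_of_superset (hO.mem_nhds hy) subset_closure
  have hbx : ContDiffAt ℝ 2 b x := hb.contDiffAt (hcl x hx)
  have hb1 : HasFDerivAt b (fderiv ℝ b x) x := (hbx.differentiableAt (by simp)).hasFDerivAt
  have hD1 : HasFDerivAt (fderiv ℝ b) (fderiv ℝ (fderiv ℝ b) x) x :=
    ((hbx.fderiv_right (m := 1) (by norm_num)).differentiableAt (by simp)).hasFDerivAt
  have hsymm : IsSymmSndFDerivAt ℝ b x := hbx.isSymmSndFDerivAt (by simp)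
  set e : Fin d → Eu d := fun k => EuclideanSpace.single k 1 with he
  have hFd : DifferentiableAt ℝ (strainField O b) x :=
    ((contDiffOn_strainField hu hb).contDiffAt (hcl x hx)).differentiableAt (by simp)
  have hD : ∀ k v, (fderiv ℝ (strainField O b) x v) k
      = ⟪b x, fderiv ℝ (fderiv ℝ b) x v (e k)⟫ + ⟪fderiv ℝ b x v, fderiv ℝ b x (e k)⟫
        + ((fderiv ℝ b x (fderiv ℝ b x v)) k + (fderiv ℝ (fderiv ℝ b) x v (b x)) k) := by
    intro k v
    rw [← fderiv_coord hFd]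
    have heq : (fun y => strainField O b y k) =ᶠ[𝓝 x] fun y =>
        ⟪b y, fderiv ℝ b y (e k)⟫ + (fderiv ℝ b y (b y)) k := by
      filter_upwards [hO.mem_nhds hx] with y hy
      simp only [strainField, he]
      rw [fderivWithin_of_mem_nhds (hcl y hy)]
    rw [heq.fderiv_eq]
    have h1 := hb1.inner ℝ (hD1.clm_apply (hasFDerivAt_const (e k) x))
    have h2 := ((EuclideanSpace.proj (𝕜 := ℝ) k).hasFDerivAt
      (x := fderiv ℝ b x (b x))).comp x (hD1.clm_apply hb1)
    have h3 := h1.add h2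
    have h4 : fderiv ℝ (fun y => ⟪b y, fderiv ℝ b y (e k)⟫ + (fderiv ℝ b y (b y)) k) x = _ :=
      h3.fderiv
    rw [h4]
    simp [fderivInnerCLM_apply]
  have hdiv' : ∑ k, (fderiv ℝ (fderiv ℝ b) x (b x) (e k)) k = 0 := by
    have h1 : HasFDerivAt (fun y => ∑ k, (fderiv ℝ b y (e k)) k)
        (∑ k, (EuclideanSpace.proj (𝕜 := ℝ) k : Eu d →L[ℝ] ℝ) ∘L
          (fderiv ℝ (fderiv ℝ b) x).flip (e k)) x := by
      refine HasFDerivAt.fun_sum fun k _ => ?_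
      have h2 := hD1.clm_apply (hasFDerivAt_const (e k) x)
      have h3 := ((EuclideanSpace.proj (𝕜 := ℝ) k).hasFDerivAt
        (x := fderiv ℝ b x (e k))).comp x h2
      rw [ContinuousLinearMap.comp_zero, zero_add] at h3
      exact h3
    have h4 : (fun y => ∑ k, (fderiv ℝ b y (e k)) k) =ᶠ[𝓝 x] fun _ => 0 := by
      filter_upwards [hO.mem_nhds hx] with y hy using hdiv y hy
    have h5 := h1.fderiv
    rw [h4.fderiv_eq, fderiv_fun_const] at h5
    simpa using (congrArg (fun L => L (b x)) h5).symm
  have hlap' : ∑ k, ⟪b x, fderiv ℝ (fderiv ℝ b) x (e k) (e k)⟫ = 0 := by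
    have h1 := hlap x hx
    rw [InnerProductSpace.laplacianWithin_eq_iteratedFDerivWithin_orthonormalBasis b hu
      (subset_closure hx) (EuclideanSpace.basisFun (Fin d) ℝ)] at h1
    have h2 : iteratedFDerivWithin ℝ 2 b (closure O) x = iteratedFDeriv ℝ 2 b x :=
      iteratedFDerivWithin_eq_iteratedFDeriv hu (by exact_mod_cast hbx) (subset_closure hx)
    rw [h2, real_inner_comm, inner_sum] at h1
    simpa [iteratedFDeriv_two_apply, he] using h1
  have hsum : dvg (strainField O b) x = ∑ k, ⟪b x, fderiv ℝ (fderiv ℝ b) x (e k) (e k)⟫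
      + ∑ k, (fderiv ℝ (fderiv ℝ b) x (b x) (e k)) k
      + ∑ k, (⟪fderiv ℝ b x (e k), fderiv ℝ b x (e k)⟫
          + (fderiv ℝ b x (fderiv ℝ b x (e k))) k) := by
    rw [dvg, ← Finset.sum_add_distrib, ← Finset.sum_add_distrib]
    refine Finset.sum_congr rfl fun k _ => ?_
    rw [hD k, hsymm.eq (e k) (b x)]
    ring
  rw [hsum, hlap', hdiv', zero_add, zero_add]
  refine Finset.sum_congr rfl fun k _ => ?_
  rw [Finset.sum_add_distrib]
  congr 1
  · rw [PiLp.inner_apply]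
    refine Finset.sum_congr rfl fun j _ => ?_
    simp [pow_two, he]
  · conv_lhs => rw [clm_apply_eq_sum (fderiv ℝ b x) (fderiv ℝ b x (e k))]
    simp [he]

theorem sum_sq_add_mul_swap {ι : Type*} [Fintype ι] (M : ι → ι → ℝ) :
    ∑ k, ∑ j, (M k j ^ 2 + M k j * M j k) = 2⁻¹ * ∑ k, ∑ j, (M k j + M j k) ^ 2 := by
  have h : ∑ k, ∑ j, (M k j + M j k) ^ 2
      = ∑ k, ∑ j, (M k j ^ 2 + M k j * M j k) + ∑ k, ∑ j, (M j k ^ 2 + M j k * M k j) := by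
    simp only [← Finset.sum_add_distrib]
    exact Finset.sum_congr rfl fun k _ => Finset.sum_congr rfl fun j _ => by ring
  rw [h, Finset.sum_comm (f := fun k j => M j k ^ 2 + M j k * M k j)]
  ring

/-- The divergence of the strain field is ½|Db + (Db)ᵀ|², nonnegative and continuous, with integral
0 by the divergence theorem; hence it vanishes pointwise. -/
theorem inner_fderiv_self_eq_zero (hO : IsOpen O) (hbd : Bornology.IsBounded O)
    (hbdry : HasC2Boundary O) {b : Eu d → Eu d}
    (hb : ContDiffOn ℝ 2 b (closure O)) (hdiv : ∀ x ∈ O, dvg b x = 0)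
    (hlap : ∀ x ∈ O, ⟪(Δ[closure O] b) x, b x⟫ = 0) (htan : IsTangential O (strainField O b))
    {x : Eu d} (hx : x ∈ O) (u : Eu d) : ⟪fderiv ℝ b x u, u⟫ = 0 := by
  have hu := hbdry.uniqueDiffOn_closure hO
  have hF := contDiffOn_strainField hu hb
  have hint := integrableOn_dvg hO hbd hbdry hF
  have h0 := setIntegral_dvg_eq_zero hO hbd hbdry hF.continuousOn (hF.mono subset_closure) hint htan
  have heq : ∀ y ∈ O, dvg (strainField O b) y = 2⁻¹ * ∑ k, ∑ j,
      ((fderiv ℝ b y (EuclideanSpace.single k 1)) j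
        + (fderiv ℝ b y (EuclideanSpace.single j 1)) k) ^ 2 := fun y hy => by
    rw [dvg_strainField hO hu hb hdiv hlap hy, sum_sq_add_mul_swap]
  have hnn : ∀ y ∈ O, 0 ≤ dvg (strainField O b) y := fun y hy => by
    rw [heq y hy]; positivity
  rw [setIntegral_eq_zero_iff_of_nonneg_ae (by
    filter_upwards [ae_restrict_mem hO.measurableSet] with y hy using hnn y hy) hint] at h0
  have hz := Measure.eqOn_open_of_ae_eq h0 hO (continuousOn_dvg hO (hF.mono subset_closure))
    continuousOn_const hx
  rw [heq x hx, Pi.zero_apply] at hz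
  have hskew : ∀ k j, (fderiv ℝ b x (EuclideanSpace.single k 1)) j
      = - (fderiv ℝ b x (EuclideanSpace.single j 1)) k := by
    intro k j
    have h1 := (Finset.sum_eq_zero_iff_of_nonneg (fun k _ => by positivity)).1
      ((mul_eq_zero.1 hz).resolve_left (by norm_num)) k (Finset.mem_univ _)
    have h2 := (Finset.sum_eq_zero_iff_of_nonneg (fun k _ => by positivity)).1 h1 j
      (Finset.mem_univ _)
    have := pow_eq_zero_iff (two_ne_zero) |>.1 h2
    linarith
  have hs : ⟪fderiv ℝ b x u, u⟫
      = ∑ k, ∑ j, u k * u j * (fderiv ℝ b x (EuclideanSpace.single k 1)) j := by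
    rw [clm_apply_eq_sum (fderiv ℝ b x) u, sum_inner]
    refine Finset.sum_congr rfl fun k _ => ?_
    rw [inner_smul_left, PiLp.inner_apply, Finset.mul_sum]
    refine Finset.sum_congr rfl fun j _ => ?_
    simp
    ring
  have hs' : ⟪fderiv ℝ b x u, u⟫ = - ⟪fderiv ℝ b x u, u⟫ := by
    conv_lhs => rw [hs, Finset.sum_comm]
    rw [hs, ← Finset.sum_neg_distrib]
    refine Finset.sum_congr rfl fun k _ => ?_
    rw [← Finset.sum_neg_distrib]
    refine Finset.sum_congr rfl fun j _ => ?_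
    rw [hskew j k]
    ring
  linarith

/-- A field whose derivative is skew is affine. -/
theorem exists_affine_of_inner_fderiv_self_eq_zero (hO : IsOpen O) (hconn : IsConnected O)
    {b : Eu d → Eu d} (hb : ContDiffOn ℝ 2 b O)
    (hskew : ∀ x ∈ O, ∀ u, ⟪fderiv ℝ b x u, u⟫ = 0) :
    ∃ (A : Eu d →L[ℝ] Eu d) (c : Eu d), (∀ u, ⟪A u, u⟫ = 0) ∧ ∀ x ∈ O, b x = A x + c := by
  obtain ⟨x₀, hx₀⟩ := hconn.nonempty
  have hbx : ∀ x ∈ O, ContDiffAt ℝ 2 b x := fun x hx => hb.contDiffAt (hO.mem_nhds hx)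
  have hDdiff : ∀ x ∈ O, DifferentiableAt ℝ (fderiv ℝ b) x := fun x hx =>
    ((hbx x hx).fderiv_right (m := 1) (by norm_num)).differentiableAt (by simp)
  have hpol : ∀ x ∈ O, ∀ u v, ⟪fderiv ℝ b x u, v⟫ + ⟪fderiv ℝ b x v, u⟫ = 0 := by
    intro x hx u v
    have h := hskew x hx (u + v)
    rw [map_add, inner_add_left, inner_add_right, inner_add_right, hskew x hx u,
      hskew x hx v] at h
    linarith
  have hD2 : EqOn (fderiv ℝ (fderiv ℝ b)) 0 O := by
    intro x hx
    have hsymm : IsSymmSndFDerivAt ℝ b x := (hbx x hx).isSymmSndFDerivAt (by simp)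
    -- The trilinear form ⟨D²b(w, u), v⟩ is symmetric in (w, u) and antisymmetric in (u, v);
    -- permuting the arguments cyclically shows that it is 0.
    have hanti : ∀ w u v, ⟪fderiv ℝ (fderiv ℝ b) x w u, v⟫
        = - ⟪fderiv ℝ (fderiv ℝ b) x w v, u⟫ := by
      intro w u v
      have hD1 := (hDdiff x hx).hasFDerivAt
      have h1 := ((hD1.clm_apply (hasFDerivAt_const u x)).inner ℝ (hasFDerivAt_const v x)).add
        ((hD1.clm_apply (hasFDerivAt_const v x)).inner ℝ (hasFDerivAt_const u x))
      have h2 : (fun y => ⟪fderiv ℝ b y u, v⟫ + ⟪fderiv ℝ b y v, u⟫) =ᶠ[𝓝 x] fun _ => 0 := by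
        filter_upwards [hO.mem_nhds hx] with y hy using hpol y hy u v
      have h3 : fderiv ℝ (fun y => ⟪fderiv ℝ b y u, v⟫ + ⟪fderiv ℝ b y v, u⟫) x = _ := h1.fderiv
      rw [h2.fderiv_eq, fderiv_fun_const] at h3
      have h4 := congrArg (fun L => L w) h3
      simp [fderivInnerCLM_apply] at h4
      linarith
    refine ContinuousLinearMap.ext fun u => ContinuousLinearMap.ext fun v => ?_
    refine ext_inner_right ℝ fun w => ?_
    simp only [Pi.zero_apply, _root_.zero_apply, inner_zero_left]
    have e1 := hanti u v w
    have e2 := hanti w u v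
    have e3 := hanti v w u
    rw [hsymm.eq u w] at e1
    rw [hsymm.eq w v] at e2
    rw [hsymm.eq v u] at e3
    linarith
  have hconst : ∀ x ∈ O, fderiv ℝ b x = fderiv ℝ b x₀ := fun x hx =>
    hO.is_const_of_fderiv_eq_zero hconn.isPreconnected
      (fun y hy => (hDdiff y hy).differentiableWithinAt) hD2 hx hx₀
  refine ⟨fderiv ℝ b x₀, b x₀ - fderiv ℝ b x₀ x₀, hskew x₀ hx₀, fun x hx => ?_⟩
  have hd : ∀ y ∈ O, HasFDerivAt (fun y => b y - fderiv ℝ b x₀ y) (0 : Eu d →L[ℝ] Eu d) y := by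
    intro y hy
    have h1 := ((hbx y hy).differentiableAt (by simp)).hasFDerivAt.sub
      (fderiv ℝ b x₀).hasFDerivAt
    rw [hconst y hy, sub_self] at h1
    exact h1
  have := hO.is_const_of_fderiv_eq_zero (𝕜 := ℝ) hconn.isPreconnected
    (fun y hy => (hd y hy).differentiableAt.differentiableWithinAt)
    (fun y hy => (hd y hy).fderiv) hx hx₀
  rw [← sub_eq_iff_eq_add', this]

theorem trace_eq_zero_of_skew {A : Eu d →L[ℝ] Eu d} (hA : ∀ u, ⟪A u, u⟫ = 0) :
    ∑ k, (A (EuclideanSpace.single k 1)) k = 0 :=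
  Finset.sum_eq_zero fun k _ => by
    simpa [EuclideanSpace.inner_single_right] using hA (EuclideanSpace.single k 1)

theorem dvg_mul_affine {A : Eu d →L[ℝ] Eu d} (hA : ∀ u, ⟪A u, u⟫ = 0) (c : Eu d) {f : Eu d → ℝ}
    {x : Eu d} (hf : DifferentiableAt ℝ f x) :
    dvg (fun y => f y • (A y + c)) x = fderiv ℝ f x (A x + c) := by
  have h1 : HasFDerivAt (fun y => f y • (A y + c)) _ x :=
    hf.hasFDerivAt.smul (A.hasFDerivAt.add_const c)
  rw [dvg, h1.fderiv, clm_apply_eq_sum (fderiv ℝ f x)]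
  have h2 := trace_eq_zero_of_skew hA
  simp only [_root_.add_apply, _root_.smul_apply, ContinuousLinearMap.smulRight_apply,
    PiLp.add_apply, PiLp.smul_apply, smul_eq_mul, Finset.sum_add_distrib, ← Finset.mul_sum, h2,
    mul_zero, zero_add]
  exact Finset.sum_congr rfl fun k _ => by ring

/-- The field f(Ax + c) is tangential, and since tr A = 0 its divergence is the derivative of f
along Ax + c. -/
theorem setIntegral_fderiv_apply_affine_eq_zero (hO : IsOpen O) (hbd : Bornology.IsBounded O)
    (hbdry : HasC2Boundary O) {A : Eu d →L[ℝ] Eu d} (hA : ∀ u, ⟪A u, u⟫ = 0) {c : Eu d}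
    (htan : IsTangential O fun y => A y + c) {f : Eu d → ℝ} (hf : ContDiff ℝ 1 f) :
    ∫ x in O, fderiv ℝ f x (A x + c) = 0 := by
  have hF : ContDiff ℝ 1 fun y => f y • (A y + c) := by fun_prop
  have h := setIntegral_dvg_eq_zero hO hbd hbdry hF.continuous.continuousOn hF.contDiffOn
    (integrableOn_dvg hO hbd hbdry hF.contDiffOn) (by
      intro x hx φ hφ
      rw [map_smul, htan x hx φ hφ, smul_zero])
  simpa only [dvg_mul_affine hA c (hf.differentiable (by simp) _)] using h

/-- A tangential infinitesimal rigid motion vanishes at the barycenter. -/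
theorem exists_fixed_point (hO : IsOpen O) (hne : O.Nonempty) (hbd : Bornology.IsBounded O)
    (hbdry : HasC2Boundary O) {A : Eu d →L[ℝ] Eu d} (hA : ∀ u, ⟪A u, u⟫ = 0) {c : Eu d}
    (htan : IsTangential O fun y => A y + c) : ∃ p : Eu d, ∀ x, A x + c = A (x - p) := by
  have hK : IsCompact (closure O) := hbd.isCompact_closure
  have hv : volume.real O ≠ 0 :=
    (ENNReal.toReal_pos (hO.measure_pos volume hne).ne' hbd.measure_lt_top.ne).ne'
  have hint : ∀ G : Eu d → Eu d, Continuous G → IntegrableOn G O := fun G hG =>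
    (hG.continuousOn.integrableOn_compact hK).mono_set subset_closure
  -- Take coordinate functions for f. The vanishing mean says that A sends the barycenter to -c.
  have h0 : ∫ x in O, (A x + c) = 0 := by
    ext k
    have h1 := setIntegral_fderiv_apply_affine_eq_zero hO hbd hbdry hA htan
      (f := fun y => EuclideanSpace.proj (𝕜 := ℝ) k y)
      (EuclideanSpace.proj (𝕜 := ℝ) k : Eu d →L[ℝ] ℝ).contDiff
    have h2 := (EuclideanSpace.proj (𝕜 := ℝ) k : Eu d →L[ℝ] ℝ).integral_comp_comm
      (hint (fun x => A x + c) (by fun_prop))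
    simp only [ContinuousLinearMap.fderiv] at h1
    rw [h1] at h2
    exact h2.symm
  refine ⟨(volume.real O)⁻¹ • ∫ x in O, x, fun x => ?_⟩
  rw [integral_add (hint _ A.continuous) (hint _ continuous_const),
    A.integral_comp_comm (hint (fun x => x) continuous_id), setIntegral_const] at h0
  have h3 : A ((volume.real O)⁻¹ • ∫ x in O, x) = - c := by
    rw [map_smul, eq_neg_of_add_eq_zero_left h0, smul_neg, smul_smul, inv_mul_cancel₀ hv, one_smul]
  rw [map_sub, h3, sub_neg_eq_add]

/-- Collects the rigidity argument. Afterwards only A, p and the continuity of `b i` matter. -/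
theorem NoiseAssumption.exists_rotation {N : ℕ} (hO : IsOpen O) (hconn : IsConnected O)
    (hbd : Bornology.IsBounded O) (hbdry : HasC2Boundary O) {ν : Eu d → Eu d}
    (hν : ∀ x ∈ frontier O, IsOuterUnitNormalAt O x (ν x))
    {b : Fin N → Eu d → Eu d} (hb : NoiseAssumption O ν b) (i : Fin N) :
    ∃ (A : Eu d →L[ℝ] Eu d) (p : Eu d), (∀ u, ⟪A u, u⟫ = 0) ∧
      (IsTangential O fun x => A (x - p)) ∧ ∀ x ∈ O, b i x = A (x - p) := by
  have hdiv : ∀ x ∈ O, dvg (b i) x = 0 := by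
    intro x hx
    have h := hb.divergence_eq_zero i x (subset_closure hx)
    rwa [divergence, fderivWithin_of_mem_nhds
      (mem_of_superset (hO.mem_nhds hx) subset_closure)] at h
  have htan' : IsTangential O (strainField O (b i)) :=
    isTangential_of_inner_normal hO hν fun x hx => by
      rw [inner_strainField]
      exact hb.boundary i x hx
  obtain ⟨A, c, hA, hAc⟩ := exists_affine_of_inner_fderiv_self_eq_zero hO hconn
    ((hb.contDiffOn i).mono subset_closure) fun x hx u =>
      inner_fderiv_self_eq_zero hO hbd hbdry (hb.contDiffOn i) hdiv
        (fun y hy => hb.inner_laplacian_eq_zero i y (subset_closure hy)) htan' hx u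
  -- Tangency lives on the boundary, so the affine formula has to be extended there by continuity.
  have heq : EqOn (b i) (fun x => A x + c) (closure O) :=
    EqOn.of_subset_closure hAc (hb.contDiffOn i).continuousOn
      (by fun_prop) subset_closure subset_rfl
  have htan : IsTangential O fun x => A x + c :=
    isTangential_of_inner_normal hO hν fun x hx => by
      have h := heq hx.1
      simp only at h
      rw [← h]
      exact hb.tangential i x hx
  obtain ⟨p, hp⟩ := exists_fixed_point hO hconn.nonempty hbd hbdry hA htan
  simp only [hp] at htan hAc
  exact ⟨A, p, hA, htan, hAc⟩

end Rigidity

/-! ### The rotation group generated by the coefficient field -/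

section Rotation

variable {d : ℕ} {O : Set (Eu d)}

section Exponential

variable {E : Type*} [NormedAddCommGroup E] [InnerProductSpace ℝ E]

theorem inner_comm_of_skew {A : E →L[ℝ] E} (hA : ∀ u, ⟪A u, u⟫ = 0) (u v : E) :
    ⟪A u, v⟫ = - ⟪u, A v⟫ := by
  have h := hA (u + v)
  rw [map_add, inner_add_left, inner_add_right, inner_add_right, hA u, hA v,
    real_inner_comm u (A v)] at h
  linarith

variable [CompleteSpace E]

theorem exp_add_smul (A : E →L[ℝ] E) (s t : ℝ) :
    NormedSpace.exp ((s + t) • A) = NormedSpace.exp (s • A) * NormedSpace.exp (t • A) := by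
  let _ : NormedAlgebra ℚ (E →L[ℝ] E) := NormedAlgebra.restrictScalars ℚ ℝ _
  rw [add_smul, NormedSpace.exp_add_of_commute]
  exact ((Commute.refl A).smul_left s).smul_right t

theorem exp_neg_mul_exp (A : E →L[ℝ] E) (t : ℝ) (u : E) :
    NormedSpace.exp ((-t) • A) (NormedSpace.exp (t • A) u) = u := by
  have h := exp_add_smul A (-t) t
  rw [neg_add_cancel, zero_smul, NormedSpace.exp_zero] at h
  exact (congrArg (fun L => L u) h).symm

theorem hasDerivAt_exp_apply (A : E →L[ℝ] E) (u : E) (t : ℝ) :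
    HasDerivAt (fun s : ℝ => NormedSpace.exp (s • A) u) (A (NormedSpace.exp (t • A) u)) t := by
  simpa using (hasDerivAt_exp_smul_const' A t).clm_apply (hasDerivAt_const t u)

theorem inner_exp_apply {A : E →L[ℝ] E} (hA : ∀ u, ⟪A u, u⟫ = 0) (t : ℝ) (u v : E) :
    ⟪NormedSpace.exp (t • A) u, NormedSpace.exp (t • A) v⟫ = ⟪u, v⟫ := by
  have hd : ∀ s, HasDerivAt
      (fun s : ℝ => ⟪NormedSpace.exp (s • A) u, NormedSpace.exp (s • A) v⟫) 0 s := by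
    intro s
    have h := (hasDerivAt_exp_apply A u s).inner ℝ (hasDerivAt_exp_apply A v s)
    rwa [inner_comm_of_skew hA, add_neg_cancel] at h
  have := is_const_of_deriv_eq_zero (fun s => (hd s).differentiableAt) (fun s => (hd s).deriv) t 0
  simpa using this

/-- The orthogonal transformation `exp (t A)`, for a skew operator `A`. -/
def rot (A : E →L[ℝ] E) (hA : ∀ u, ⟪A u, u⟫ = 0) (t : ℝ) : E ≃ₗᵢ[ℝ] E :=
  LinearEquiv.isometryOfInner
    (LinearEquiv.ofLinearMap (NormedSpace.exp (t • A) : E →L[ℝ] E).toLinearMap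
      (NormedSpace.exp ((-t) • A) : E →L[ℝ] E).toLinearMap
      (LinearMap.ext fun u => by simpa using exp_neg_mul_exp A (-t) u)
      (LinearMap.ext fun u => exp_neg_mul_exp A t u))
    (inner_exp_apply hA t)

theorem rot_apply (A : E →L[ℝ] E) (hA : ∀ u, ⟪A u, u⟫ = 0) (t : ℝ) (u : E) :
    rot A hA t u = NormedSpace.exp (t • A) u := rfl

theorem rot_add (A : E →L[ℝ] E) (hA : ∀ u, ⟪A u, u⟫ = 0) (s t : ℝ) (u : E) :
    rot A hA (s + t) u = rot A hA s (rot A hA t u) := by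
  rw [rot_apply, exp_add_smul]
  rfl

theorem rot_zero (A : E →L[ℝ] E) (hA : ∀ u, ⟪A u, u⟫ = 0) (u : E) : rot A hA 0 u = u := by
  rw [rot_apply, zero_smul, NormedSpace.exp_zero]
  rfl

theorem hasDerivAt_rot (A : E →L[ℝ] E) (hA : ∀ u, ⟪A u, u⟫ = 0) (u : E) (t : ℝ) :
    HasDerivAt (fun s : ℝ => rot A hA s u) (A (rot A hA t u)) t :=
  hasDerivAt_exp_apply A u t

theorem rot_apply_comm (A : E →L[ℝ] E) (hA : ∀ u, ⟪A u, u⟫ = 0) (u : E) (t : ℝ) :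
    rot A hA t (A u) = A (rot A hA t u) := by
  have h : Commute A (NormedSpace.exp (t • A)) := ((Commute.refl A).smul_right t).exp_right
  exact (congrArg (fun L => L u) h.eq).symm

end Exponential

/-- The rigid motion with linear part `L` that fixes `p`. -/
def rigid (p : Eu d) (L : Eu d ≃ₗᵢ[ℝ] Eu d) (x : Eu d) : Eu d := p + L (x - p)

theorem rigid_symm_rigid (p : Eu d) (L : Eu d ≃ₗᵢ[ℝ] Eu d) (x : Eu d) :
    rigid p L.symm (rigid p L x) = x := by
  simp [rigid]

theorem rigid_rigid_symm (p : Eu d) (L : Eu d ≃ₗᵢ[ℝ] Eu d) (x : Eu d) :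
    rigid p L (rigid p L.symm x) = x := by
  simp [rigid]

theorem contDiff_rigid {n : WithTop ℕ∞} (p : Eu d) (L : Eu d ≃ₗᵢ[ℝ] Eu d) :
    ContDiff ℝ n (rigid p L) :=
  contDiff_const.add (L.toContinuousLinearEquiv.contDiff.comp (contDiff_id.sub contDiff_const))

theorem continuous_rigid (p : Eu d) (L : Eu d ≃ₗᵢ[ℝ] Eu d) : Continuous (rigid p L) :=
  (contDiff_rigid (n := 0) p L).continuous

theorem hasFDerivAt_rigid (p : Eu d) (L : Eu d ≃ₗᵢ[ℝ] Eu d) (x : Eu d) :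
    HasFDerivAt (rigid p L) (L.toContinuousLinearEquiv : Eu d →L[ℝ] Eu d) x := by
  have h := (L.toContinuousLinearEquiv.hasFDerivAt (x := x - p)).comp x
    ((hasFDerivAt_id x).sub_const p)
  exact h.const_add p

/-- Rigid motions as homeomorphisms. -/
def rigidHomeomorph (p : Eu d) (L : Eu d ≃ₗᵢ[ℝ] Eu d) : Eu d ≃ₜ Eu d where
  toFun := rigid p L
  invFun := rigid p L.symm
  left_inv := rigid_symm_rigid p L
  right_inv := rigid_rigid_symm p L
  continuous_toFun := continuous_rigid p L
  continuous_invFun := continuous_rigid p L.symm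

theorem measurePreserving_rigid (p : Eu d) (L : Eu d ≃ₗᵢ[ℝ] Eu d) :
    MeasurePreserving (rigid p L) :=
  (measurePreserving_add_left volume p).comp
    (L.measurePreserving.comp (measurePreserving_sub_right volume p))

/-! ### The flow of x ↦ A(x - p) and the invariance of the domain. -/

theorem hasDerivAt_rigid_rot (A : Eu d →L[ℝ] Eu d) (hA : ∀ u, ⟪A u, u⟫ = 0) (p x : Eu d) (t : ℝ) :
    HasDerivAt (fun s => rigid p (rot A hA s) x) (A (rigid p (rot A hA t) x - p)) t := by
  have h := (hasDerivAt_rot A hA (x - p) t).const_add p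
  simpa [rigid] using h

theorem rigid_rot_add (A : Eu d →L[ℝ] Eu d) (hA : ∀ u, ⟪A u, u⟫ = 0) (p : Eu d) (s t : ℝ)
    (x : Eu d) : rigid p (rot A hA (s + t)) x = rigid p (rot A hA s) (rigid p (rot A hA t) x) := by
  simp [rigid, rot_add]

theorem rigid_rot_zero (A : Eu d →L[ℝ] Eu d) (hA : ∀ u, ⟪A u, u⟫ = 0) (p x : Eu d) :
    rigid p (rot A hA 0) x = x := by
  simp [rigid, rot_zero]

/-- The weight w serves two purposes: w = 1 gives the invariance of `O`, and w = u ∈ L² gives the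
derivative of the group on L². -/
theorem hasDerivAt_setIntegral_comp_rigid (A : Eu d →L[ℝ] Eu d) (hA : ∀ u, ⟪A u, u⟫ = 0)
    (p : Eu d) {w ψ : Eu d → ℝ} (hw : IntegrableOn w O) (hψ : ContDiff ℝ 1 ψ)
    (hc : HasCompactSupport ψ) (t : ℝ) :
    HasDerivAt (fun s => ∫ x in O, w x * ψ (rigid p (rot A hA s) x))
      (∫ x in O, w x * fderiv ℝ ψ (rigid p (rot A hA t) x) (A (rigid p (rot A hA t) x - p))) t := by
  have hg : Continuous fun y => fderiv ℝ ψ y (A (y - p)) :=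
    (hψ.continuous_fderiv one_ne_zero).clm_apply (by fun_prop)
  have hgc : HasCompactSupport fun y => fderiv ℝ ψ y (A (y - p)) := by
    refine (hc.fderiv (𝕜 := ℝ)).mono fun y hy => ?_
    rw [Function.mem_support] at hy ⊢
    intro h
    exact hy (by rw [h]; rfl)
  obtain ⟨C, hC⟩ := hgc.exists_bound_of_continuous hg
  obtain ⟨C', hC'⟩ := hc.exists_bound_of_continuous hψ.continuous
  refine (hasDerivAt_integral_of_dominated_loc_of_deriv_le
    (F := fun s x => w x * ψ (rigid p (rot A hA s) x))
    (F' := fun s x => w x * fderiv ℝ ψ (rigid p (rot A hA s) x) (A (rigid p (rot A hA s) x - p)))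
    (bound := fun x => ‖w x‖ * C) (s := univ) univ_mem
    (Eventually.of_forall fun s => ?_) ?_ ?_ ?_ (hw.norm.mul_const C) ?_).2
  · exact hw.aestronglyMeasurable.mul
      (hψ.continuous.comp (continuous_rigid _ _)).aestronglyMeasurable
  · exact hw.mul_bdd (hψ.continuous.comp (continuous_rigid _ _)).aestronglyMeasurable
      (ae_of_all _ fun x => hC' _)
  · exact hw.aestronglyMeasurable.mul (hg.comp (continuous_rigid _ _)).aestronglyMeasurable
  · refine ae_of_all _ fun x s _ => ?_
    rw [norm_mul]
    exact mul_le_mul_of_nonneg_left (hC _) (norm_nonneg _)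
  · refine ae_of_all _ fun x s _ => ?_
    exact ((hψ.differentiable one_ne_zero _).hasFDerivAt.comp_hasDerivAt s
      (hasDerivAt_rigid_rot A hA p x s)).const_mul _

/-- The t-derivative is the integral over `O` of the derivative of ψ ∘ Φ_t along the field, because
exp(tA) commutes with A; it is 0 by the divergence theorem. -/
theorem setIntegral_comp_rigid_eq (hO : IsOpen O) (hbd : Bornology.IsBounded O)
    (hbdry : HasC2Boundary O) (A : Eu d →L[ℝ] Eu d) (hA : ∀ u, ⟪A u, u⟫ = 0) (p : Eu d)
    (htan : IsTangential O fun x => A (x - p)) {ψ : Eu d → ℝ} (hψ : ContDiff ℝ 1 ψ)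
    (hc : HasCompactSupport ψ) (t : ℝ) :
    ∫ x in O, ψ (rigid p (rot A hA t) x) = ∫ x in O, ψ x := by
  have hd : ∀ s, HasDerivAt (fun s => ∫ x in O, ψ (rigid p (rot A hA s) x)) 0 s := by
    intro s
    have h := hasDerivAt_setIntegral_comp_rigid (O := O) A hA p (w := fun _ => 1)
      (integrableOn_const hbd.measure_lt_top.ne) hψ hc s
    simp only [one_mul] at h
    have htan' : IsTangential O fun x => A x + (- A p) := by
      simpa only [map_sub, ← sub_eq_add_neg] using htan
    have h0 := setIntegral_fderiv_apply_affine_eq_zero hO hbd hbdry hA htan'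
      (f := fun x => ψ (rigid p (rot A hA s) x)) (hψ.comp (contDiff_rigid _ _))
    rw [← h0]
    convert h using 3 with x
    have h1 : HasFDerivAt (fun x => ψ (rigid p (rot A hA s) x)) _ x :=
      (hψ.differentiable one_ne_zero _).hasFDerivAt.comp x (hasFDerivAt_rigid p (rot A hA s) x)
    rw [h1.fderiv]
    change fderiv ℝ ψ _ (rot A hA s (A x + -A p)) = _
    rw [← sub_eq_add_neg, ← map_sub, rot_apply_comm]
    simp [rigid]
  have := is_const_of_deriv_eq_zero (fun s => (hd s).differentiableAt) (fun s => (hd s).deriv) t 0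
  simpa only [rigid_rot_zero] using this

/-- If Φ_t moved a point of `O` outside `closure O`, a nonnegative bump there would have integral 0
over `O`, but its composition with Φ_t would not. So Φ_t(O) is an open subset of `closure O`, hence
of `O`. -/
theorem rigid_rot_mem (hO : IsOpen O) (hbd : Bornology.IsBounded O)
    (hbdry : HasC2Boundary O) (A : Eu d →L[ℝ] Eu d) (hA : ∀ u, ⟪A u, u⟫ = 0) (p : Eu d)
    (htan : IsTangential O fun x => A (x - p)) (t : ℝ) {x : Eu d} (hx : x ∈ O) :
    rigid p (rot A hA t) x ∈ O := by
  have hcl : ∀ y ∈ O, rigid p (rot A hA t) y ∈ closure O := by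
    intro y hy
    by_contra hn
    obtain ⟨ψ, h1, h2, h3, h4, h5⟩ := exists_contDiff_tsupport_subset (n := 1)
      (isClosed_closure.isOpen_compl.mem_nhds hn)
    have h0 : ∫ x in O, ψ x = 0 := by
      rw [setIntegral_congr_fun (g := fun _ => (0 : ℝ)) hO.measurableSet, integral_zero]
      intro z hz
      exact image_eq_zero_of_notMem_tsupport fun h => h1 h (subset_closure hz)
    rw [← setIntegral_comp_rigid_eq hO hbd hbdry A hA p htan h3 h2 t] at h0
    have hcont : Continuous fun x => ψ (rigid p (rot A hA t) x) :=
      h3.continuous.comp (continuous_rigid _ _)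
    rw [setIntegral_eq_zero_iff_of_nonneg_ae (ae_of_all _ fun z => (h4 (mem_range_self _)).1)
      ((hcont.continuousOn.integrableOn_compact hbd.isCompact_closure).mono_set subset_closure)] at h0
    have := Measure.eqOn_open_of_ae_eq h0 hO hcont.continuousOn continuousOn_const hy
    simp [h5] at this
  refine hbdry.interior_closure_subset hO ?_
  have hopen : IsOpen (rigid p (rot A hA t) '' O) :=
    (rigidHomeomorph p (rot A hA t)).isOpenMap O hO
  exact interior_maximal (by rintro _ ⟨y, hy, rfl⟩; exact hcl y hy) hopen (mem_image_of_mem _ hx)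

theorem preimage_rigid_rot (hO : IsOpen O) (hbd : Bornology.IsBounded O)
    (hbdry : HasC2Boundary O) (A : Eu d →L[ℝ] Eu d) (hA : ∀ u, ⟪A u, u⟫ = 0) (p : Eu d)
    (htan : IsTangential O fun x => A (x - p)) (t : ℝ) :
    rigid p (rot A hA t) ⁻¹' O = O := by
  refine Subset.antisymm (fun x hx => ?_) fun x hx =>
    rigid_rot_mem hO hbd hbdry A hA p htan t hx
  have h := rigid_rot_mem hO hbd hbdry A hA p htan (-t) (mem_preimage.1 hx)
  rwa [← rigid_rot_add, neg_add_cancel, rigid_rot_zero] at h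

end Rotation

/-! ### Rigid motions acting on `L²` and on weak gradients -/

section Pullback

variable {d : ℕ} {O : Set (Eu d)} {p : Eu d} {L : Eu d ≃ₗᵢ[ℝ] Eu d}

theorem measurePreserving_rigid_restrict (hO : IsOpen O) (h : rigid p L ⁻¹' O = O) :
    MeasurePreserving (rigid p L) ((volume : Measure (Eu d)).restrict O)
      ((volume : Measure (Eu d)).restrict O) := by
  have := (measurePreserving_rigid p L).restrict_preimage hO.measurableSet
  rwa [h] at this

theorem preimage_rigid_symm (h : rigid p L ⁻¹' O = O) : rigid p L.symm ⁻¹' O = O := by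
  ext x
  rw [mem_preimage]
  nth_rw 1 [← h]
  rw [mem_preimage, rigid_rigid_symm]

theorem setIntegral_comp_rigid (hO : IsOpen O) (h : rigid p L ⁻¹' O = O) (f : Eu d → ℝ) :
    ∫ x in O, f (rigid p L x) = ∫ x in O, f x :=
  (measurePreserving_rigid_restrict hO h).integral_comp
    (rigidHomeomorph p L).measurableEmbedding f

/-- Composition with a rigid motion that preserves `O`, on `L²(O)`. -/
def pull (hO : IsOpen O) (h : rigid p L ⁻¹' O = O) : L2 O →ₗᵢ[ℝ] L2 O :=
  Lp.compMeasurePreservingₗᵢ ℝ (rigid p L) (measurePreserving_rigid_restrict hO h)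

theorem coeFn_pull (hO : IsOpen O) (h : rigid p L ⁻¹' O = O) (u : L2 O) :
    ∀ᵐ x ∂((volume : Measure (Eu d)).restrict O), pull hO h u x = u (rigid p L x) :=
  Lp.coeFn_compMeasurePreserving u (measurePreserving_rigid_restrict hO h)

/-- The action of a rigid motion that preserves `O` on gradient fields. -/
def pullVec (hO : IsOpen O) (h : rigid p L ⁻¹' O = O) (g : L2Vec O) : L2Vec O :=
  (L.symm.toContinuousLinearEquiv : Eu d →L[ℝ] Eu d).compLp
    (Lp.compMeasurePreserving (rigid p L) (measurePreserving_rigid_restrict hO h) g)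

theorem coeFn_pullVec (hO : IsOpen O) (h : rigid p L ⁻¹' O = O) (g : L2Vec O) :
    ∀ᵐ x ∂((volume : Measure (Eu d)).restrict O),
      pullVec hO h g x = L.symm (g (rigid p L x)) := by
  filter_upwards [ContinuousLinearMap.coeFn_compLp
      (L.symm.toContinuousLinearEquiv : Eu d →L[ℝ] Eu d)
      (Lp.compMeasurePreserving (rigid p L) (measurePreserving_rigid_restrict hO h) g),
    Lp.coeFn_compMeasurePreserving g (measurePreserving_rigid_restrict hO h)] with x h1 h2
  rw [pullVec, h1, h2]
  rfl

/-- Change of variables by a measure-preserving map: the adjoint is the pullback by the inverse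
motion. -/
theorem inner_pull (hO : IsOpen O) (h : rigid p L ⁻¹' O = O) (v u : L2 O) :
    ⟪v, pull hO h u⟫ = ⟪pull hO (preimage_rigid_symm h) v, u⟫ := by
  rw [L2.inner_def, L2.inner_def]
  rw [← setIntegral_comp_rigid hO h fun x => ⟪pull hO (preimage_rigid_symm h) v x, u x⟫]
  refine integral_congr_ae ?_
  filter_upwards [coeFn_pull hO h u, (measurePreserving_rigid_restrict hO h).quasiMeasurePreserving.ae
    (coeFn_pull hO (preimage_rigid_symm h) v)] with x h1 h2
  rw [h1, h2, rigid_symm_rigid]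

theorem inner_pullVec (hO : IsOpen O) (h : rigid p L ⁻¹' O = O) (w g : L2Vec O) :
    ⟪w, pullVec hO h g⟫ = ⟪pullVec hO (preimage_rigid_symm h) w, g⟫ := by
  rw [L2.inner_def, L2.inner_def]
  rw [← setIntegral_comp_rigid hO h fun x => ⟪pullVec hO (preimage_rigid_symm h) w x, g x⟫]
  refine integral_congr_ae ?_
  filter_upwards [coeFn_pullVec hO h g,
    (measurePreserving_rigid_restrict hO h).quasiMeasurePreserving.ae
      (coeFn_pullVec hO (preimage_rigid_symm h) w)] with x h1 h2
  rw [h1, h2, rigid_symm_rigid, LinearIsometryEquiv.symm_symm]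
  rw [← L.inner_map_map, L.apply_symm_apply]

theorem IsTestFunction.comp_rigid (h : rigid p L ⁻¹' O = O) {ψ : Eu d → ℝ}
    (hψ : IsTestFunction O ψ) : IsTestFunction O fun x => ψ (rigid p L x) where
  contDiff := hψ.contDiff.comp (contDiff_rigid p L)
  hasCompactSupport := hψ.hasCompactSupport.comp_homeomorph (rigidHomeomorph p L)
  tsupport_subset := by
    rw [← h]
    exact (tsupport_comp_subset_preimage ψ (continuous_rigid p L)).trans
      (preimage_mono hψ.tsupport_subset)

theorem fderiv_comp_rigid {ψ : Eu d → ℝ} (hψ : Differentiable ℝ ψ) (x v : Eu d) :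
    fderiv ℝ (fun x => ψ (rigid p L x)) x v = fderiv ℝ ψ (rigid p L x) (L v) := by
  have h1 : HasFDerivAt (fun x => ψ (rigid p L x)) _ x :=
    (hψ _).hasFDerivAt.comp x (hasFDerivAt_rigid p L x)
  rw [h1.fderiv]
  rfl

/-- Chain rule ∇(u ∘ Φ) = Lᵀ(∇u) ∘ Φ with Lᵀ = L⁻¹, obtained by moving Φ⁻¹ onto the test function.
-/
theorem HasWeakGradient.pull (hO : IsOpen O) (h : rigid p L ⁻¹' O = O) {u : L2 O} {g : L2Vec O}
    (hg : HasWeakGradient O u g) :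
    HasWeakGradient O (NeumannKilling.pull hO h u) (pullVec hO h g) := by
  intro ψ hψ v
  have h' := preimage_rigid_symm h
  have hη := hψ.comp_rigid h'
  have key := hg _ hη (L v)
  rw [← setIntegral_comp_rigid hO h fun x =>
      u x * fderiv ℝ (fun x => ψ (rigid p L.symm x)) x (L v),
    ← setIntegral_comp_rigid hO h fun x => ψ (rigid p L.symm x) * ⟪g x, L v⟫] at key
  simp only [rigid_symm_rigid] at key
  have hψd := hψ.contDiff.differentiable (by simp)
  convert key using 1
  · refine integral_congr_ae ?_
    filter_upwards [coeFn_pull hO h u] with x hx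
    rw [hx, fderiv_comp_rigid hψd, rigid_symm_rigid, L.symm_apply_apply]
  · congr 1
    refine integral_congr_ae ?_
    filter_upwards [coeFn_pullVec hO h g] with x hx
    rw [hx, ← L.inner_map_map, L.apply_symm_apply]

end Pullback

/-! ### The resolvent of the Neumann Laplacian -/

section Resolvent

variable {d : ℕ} {O : Set (Eu d)}

theorem inner_toLp_eq {ψ : Eu d → ℝ} (hψ : MemLp ψ 2 ((volume : Measure (Eu d)).restrict O))
    (u : L2 O) : ⟪hψ.toLp ψ, u⟫ = ∫ x in O, u x * ψ x := by
  rw [L2.inner_def]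
  refine integral_congr_ae ?_
  filter_upwards [hψ.coeFn_toLp] with x hx
  rw [hx]
  simp

theorem isClosed_weakGradientGraph :
    IsClosed (weakGradientGraph O : Set (L2 O × L2Vec O)) := by
  have : (weakGradientGraph O : Set (L2 O × L2Vec O)) = ⋂ (ψ : Eu d → ℝ) (h : IsTestFunction O ψ)
      (v : Eu d), {q | ⟪(h.memLp_fderiv v).toLp _, q.1⟫
        = - ⟪(ContinuousLinearMap.toSpanSingleton ℝ v).compLp (h.memLp.toLp ψ), q.2⟫} := by
    ext q
    simp only [mem_iInter, mem_ofPred_eq, SetLike.mem_coe]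
    refine forall_congr' fun ψ => forall_congr' fun h => forall_congr' fun v => ?_
    rw [inner_toLp_eq, L2.inner_def]
    have : ∫ x in O, ⟪(ContinuousLinearMap.toSpanSingleton ℝ v).compLp (h.memLp.toLp ψ) x, q.2 x⟫
        = ∫ x in O, ψ x * ⟪q.2 x, v⟫ := by
      refine integral_congr_ae ?_
      filter_upwards [ContinuousLinearMap.coeFn_compLp (ContinuousLinearMap.toSpanSingleton ℝ v)
        (h.memLp.toLp ψ), h.memLp.coeFn_toLp] with x h1 h2
      rw [h1, h2, ContinuousLinearMap.toSpanSingleton_apply, real_inner_smul_left,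
        real_inner_comm]
    rw [this]
  rw [this]
  refine isClosed_iInter fun ψ => isClosed_iInter fun h => isClosed_iInter fun v => ?_
  exact isClosed_eq (by fun_prop) (by fun_prop)

/-- `u` is the weak solution of `u - δ Δ u = f` with Neumann boundary conditions. -/
def IsWeakSolution (O : Set (Eu d)) (δ : ℝ) (f u : L2 O) : Prop :=
  ∃ g : L2Vec O, HasWeakGradient O u g ∧
    ∀ (v : L2 O) (w : L2Vec O), HasWeakGradient O v w → ⟪v, u⟫ + δ * ⟪w, g⟫ = ⟪v, f⟫

/-- Test the difference of the two equations with u - u' itself. -/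
theorem IsWeakSolution.unique {δ : ℝ} (hδ : 0 < δ) {f u u' : L2 O}
    (h : IsWeakSolution O δ f u) (h' : IsWeakSolution O δ f u') : u = u' := by
  obtain ⟨g, hg, e⟩ := h
  obtain ⟨g', hg', e'⟩ := h'
  have hd : HasWeakGradient O (u - u') (g - g') :=
    (weakGradientGraph O).sub_mem (x := (u, g)) (y := (u', g')) hg hg'
  have h1 := e _ _ hd
  have h2 := e' _ _ hd
  have h3 : ⟪u - u', u - u'⟫ + δ * ⟪g - g', g - g'⟫ = 0 := by
    rw [inner_sub_right (u - u') u u', inner_sub_right (g - g') g g']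
    linarith
  have h4 : 0 ≤ δ * ⟪g - g', g - g'⟫ := mul_nonneg hδ.le real_inner_self_nonneg
  have h5 : ⟪u - u', u - u'⟫ = 0 :=
    le_antisymm (by linarith) real_inner_self_nonneg
  exact sub_eq_zero.1 (inner_self_eq_zero.1 h5)

theorem IsWeakSolution.inner_comm {δ : ℝ} {f u f' u' : L2 O}
    (h : IsWeakSolution O δ f u) (h' : IsWeakSolution O δ f' u') : ⟪u, f'⟫ = ⟪f, u'⟫ := by
  obtain ⟨g, hg, e⟩ := h
  obtain ⟨g', hg', e'⟩ := h'
  have h1 := e u' g' hg'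
  rw [real_inner_comm u u', real_inner_comm g g', real_inner_comm f u'] at h1
  rw [← e' u g hg, h1]

/-- Rigid motions preserving `O` leave the Neumann form invariant. Together with uniqueness this
says that they commute with the resolvent. -/
theorem IsWeakSolution.pull {δ : ℝ} {f u : L2 O} (h : IsWeakSolution O δ f u) (hO : IsOpen O)
    {p : Eu d} {L : Eu d ≃ₗᵢ[ℝ] Eu d} (hL : rigid p L ⁻¹' O = O) :
    IsWeakSolution O δ (NeumannKilling.pull hO hL f) (NeumannKilling.pull hO hL u) := by
  obtain ⟨g, hg, e⟩ := h
  refine ⟨_, hg.pull hO hL, fun v w hw => ?_⟩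
  rw [inner_pull, inner_pull, inner_pullVec]
  exact e _ _ (hw.pull hO (preimage_rigid_symm hL))

/-- The orthogonal projection of (f, 0) onto the closed subspace of pairs (u, √δ ∇u) has the
solution as first component: orthogonality of the residual is the weak equation. Linearity and
boundedness come from the projection. -/
theorem exists_resolvent (O : Set (Eu d)) {δ : ℝ} (hδ : 0 < δ) :
    ∃ J : L2 O →L[ℝ] L2 O, ∀ f, IsWeakSolution O δ f (J f) := by
  set c : ℝ := √δ with hc
  have hc0 : c ≠ 0 := (Real.sqrt_pos.2 hδ).ne'
  have hcc : c * c = δ := Real.mul_self_sqrt hδ.le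
  let e := WithLp.prodContinuousLinearEquiv 2 ℝ (L2 O) (L2Vec O)
  let S : (L2 O × L2Vec O) →L[ℝ] (L2 O × L2Vec O) :=
    (ContinuousLinearMap.fst ℝ _ _).prod (c⁻¹ • ContinuousLinearMap.snd ℝ _ _)
  let Φ : WithLp 2 (L2 O × L2Vec O) →L[ℝ] (L2 O × L2Vec O) := S ∘L e.toContinuousLinearMap
  let G : Submodule ℝ (WithLp 2 (L2 O × L2Vec O)) := (weakGradientGraph O).comap Φ.toLinearMap
  have hG : IsClosed (G : Set (WithLp 2 (L2 O × L2Vec O))) :=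
    isClosed_weakGradientGraph.preimage Φ.continuous
  have : CompleteSpace G := hG.completeSpace_coe
  refine ⟨ContinuousLinearMap.fst ℝ (L2 O) (L2Vec O) ∘L e.toContinuousLinearMap ∘L G.starProjection ∘L e.symm.toContinuousLinearMap ∘L
    ContinuousLinearMap.inl ℝ (L2 O) (L2Vec O), fun f => ?_⟩
  set z : WithLp 2 (L2 O × L2Vec O) := e.symm (f, 0) with hz
  set y := G.starProjection z with hy
  have hyG : y ∈ G := G.starProjection_apply_mem z
  refine ⟨c⁻¹ • y.snd, hyG, fun v w hw => ?_⟩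
  have hx : e.symm (v, c • w) ∈ G := by
    change HasWeakGradient O v (c⁻¹ • c • w)
    rwa [smul_smul, inv_mul_cancel₀ hc0, one_smul]
  have horth := G.starProjection_inner_eq_zero z _ hx
  rw [real_inner_comm, WithLp.prod_inner_apply] at horth
  have h1 : ⟪v, f - y.fst⟫ + ⟪c • w, 0 - y.snd⟫ = 0 := horth
  rw [inner_sub_right, zero_sub, inner_neg_right, real_inner_smul_left] at h1
  have h2 : δ * ⟪w, c⁻¹ • y.snd⟫ = c * ⟪w, y.snd⟫ := by
    rw [real_inner_smul_right, ← hcc]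
    field_simp
  rw [h2]
  change ⟪v, y.fst⟫ + _ = _
  linarith

end Resolvent

/-! ### The transport operator as infinitesimal generator -/

section Generator

variable {d : ℕ} {O : Set (Eu d)}

theorem transportGraph_congr (hO : IsOpen O) {b b' : Eu d → Eu d} (h : EqOn b b' O) :
    transportGraph O b = transportGraph O b' := by
  ext q
  refine exists_congr fun g => and_congr_right fun _ => ?_
  refine eventually_congr ?_
  filter_upwards [ae_restrict_mem hO.measurableSet] with x hx
  rw [h hx]

/-! ### Density of test functions. -/

theorem eq_zero_of_inner_testFunction_eq_zero (hO : IsOpen O) {u : L2 O}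
    (h : ∀ (ψ : Eu d → ℝ) (hψ : IsTestFunction O ψ), ⟪hψ.memLp.toLp ψ, u⟫ = 0) : u = 0 := by
  have hint : LocallyIntegrableOn u O (volume : Measure (Eu d)) :=
    locallyIntegrableOn_of_locallyIntegrable_restrict
      ((Lp.memLp u).locallyIntegrable (by norm_num))
  have key : ∀ᵐ x ∂(volume : Measure (Eu d)), x ∈ O → u x = 0 := by
    refine hO.ae_eq_zero_of_integral_contDiff_smul_eq_zero hint ?_
    intro ψ h1 h2 h3
    have e := h ψ ⟨h1, h2, h3⟩
    rw [inner_toLp_eq] at e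
    rw [← setIntegral_eq_integral_of_forall_compl_eq_zero (s := O), ← e]
    · simp [mul_comm]
    · intro x hx
      have : ψ x = 0 := image_eq_zero_of_notMem_tsupport (fun h' => hx (h3 h'))
      simp [this]
  refine Lp.ext ?_
  filter_upwards [(ae_restrict_iff' hO.measurableSet).2 key,
    Lp.coeFn_zero ℝ 2 ((volume : Measure (Eu d)).restrict O)] with x h1 h2
  rw [h1, h2]
  rfl

theorem IsTestFunction.add {ψ η : Eu d → ℝ} (h : IsTestFunction O ψ) (h' : IsTestFunction O η) :
    IsTestFunction O (ψ + η) :=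
  ⟨h.contDiff.add h'.contDiff, h.hasCompactSupport.add h'.hasCompactSupport,
    (tsupport_add ψ η).trans (union_subset h.tsupport_subset h'.tsupport_subset)⟩

theorem IsTestFunction.mul_left {f ψ : Eu d → ℝ} (hf : ContDiff ℝ ∞ f) (h : IsTestFunction O ψ) :
    IsTestFunction O fun x => f x * ψ x :=
  ⟨hf.mul h.contDiff, h.hasCompactSupport.mul_left,
    (tsupport_mul_subset_right (f := f) (g := ψ)).trans h.tsupport_subset⟩

/-- The subspace of `L²(O)` of all test functions. -/
def testSubmodule (O : Set (Eu d)) : Submodule ℝ (L2 O) where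
  carrier := {u | ∃ (ψ : Eu d → ℝ) (hψ : IsTestFunction O ψ), hψ.memLp.toLp ψ = u}
  zero_mem' := by
    have h0 : IsTestFunction O (0 : Eu d → ℝ) :=
      ⟨contDiff_const, HasCompactSupport.zero, by simp [tsupport]⟩
    exact ⟨0, h0, MemLp.toLp_zero h0.memLp⟩
  add_mem' := by
    rintro _ _ ⟨ψ, hψ, rfl⟩ ⟨η, hη, rfl⟩
    exact ⟨ψ + η, hψ.add hη, MemLp.toLp_add hψ.memLp hη.memLp⟩
  smul_mem' := by
    rintro c _ ⟨ψ, hψ, rfl⟩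
    exact ⟨_, hψ.mul_left (f := fun _ => c) contDiff_const, MemLp.toLp_const_smul c hψ.memLp⟩

theorem dense_testSubmodule (hO : IsOpen O) : Dense (testSubmodule O : Set (L2 O)) := by
  rw [Submodule.dense_iff_topologicalClosure_eq_top, Submodule.topologicalClosure_eq_top_iff,
    Submodule.eq_bot_iff]
  intro u hu
  refine eq_zero_of_inner_testFunction_eq_zero hO fun ψ hψ => ?_
  exact (Submodule.mem_orthogonal _ u).1 hu _ ⟨ψ, hψ, rfl⟩

theorem dense_H1 (hO : IsOpen O) : Dense (H1 O : Set (L2 O)) :=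
  (dense_testSubmodule hO).mono fun _ h => by
    obtain ⟨_, hψ, rfl⟩ := h
    exact hψ.mem_H1

theorem norm_le_of_inner_testFunction_le (hO : IsOpen O) {u : L2 O} {C : ℝ} (hC : 0 ≤ C)
    (h : ∀ (ψ : Eu d → ℝ) (hψ : IsTestFunction O ψ),
      ⟪hψ.memLp.toLp ψ, u⟫ ≤ C * ‖hψ.memLp.toLp ψ‖) : ‖u‖ ≤ C := by
  have hall : ∀ v : L2 O, ⟪v, u⟫ ≤ C * ‖v‖ := by
    intro v
    refine (dense_testSubmodule hO).induction (P := fun v => ⟪v, u⟫ ≤ C * ‖v‖) ?_ ?_ v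
    · rintro _ ⟨ψ, hψ, rfl⟩
      exact h ψ hψ
    · exact isClosed_le (by fun_prop) (by fun_prop)
  have h1 := hall u
  rw [real_inner_self_eq_norm_mul_norm] at h1
  rcases (norm_nonneg u).eq_or_lt with h0 | h0
  · rwa [← h0]
  · exact le_of_mul_le_mul_right h1 h0

variable {A : Eu d →L[ℝ] Eu d} {hA : ∀ u, ⟪A u, u⟫ = 0} {p : Eu d}

/-- Insert the test functions (A(x - p))ₖψ in the k-th direction and sum; the extra terms add up to
ψ tr A = 0. -/
theorem HasWeakGradient.setIntegral_mul_fderiv_affine {u : L2 O} {g : L2Vec O}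
    (hg : HasWeakGradient O u g) (hA : ∀ u, ⟪A u, u⟫ = 0) {ψ : Eu d → ℝ} (hψ : IsTestFunction O ψ) :
    ∫ x in O, u x * fderiv ℝ ψ x (A (x - p)) = - ∫ x in O, ψ x * ⟪A (x - p), g x⟫ := by
  have hc : ∀ k, ContDiff ℝ ∞ fun x => (A (x - p)) k := fun k =>
    (EuclideanSpace.proj (𝕜 := ℝ) k).contDiff.comp
      (A.contDiff.comp (contDiff_id.sub contDiff_const))
  have ht : ∀ k, IsTestFunction O fun x => (A (x - p)) k * ψ x := fun k => hψ.mul_left (hc k)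
  have hψd := hψ.contDiff.differentiable (by simp)
  have hd : ∀ k x, fderiv ℝ (fun x => (A (x - p)) k * ψ x) x (EuclideanSpace.single k 1)
      = (A (x - p)) k * fderiv ℝ ψ x (EuclideanSpace.single k 1)
        + ψ x * (A (EuclideanSpace.single k 1)) k := by
    intro k x
    have h1 : HasFDerivAt (fun x => (A (x - p)) k)
        ((EuclideanSpace.proj (𝕜 := ℝ) k : Eu d →L[ℝ] ℝ) ∘L A) x := by
      have h2 := ((EuclideanSpace.proj (𝕜 := ℝ) k : Eu d →L[ℝ] ℝ) ∘L A).hasFDerivAt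
        (x := x - p)
      exact h2.comp x ((hasFDerivAt_id x).sub_const p)
    rw [(h1.fun_mul (hψd x).hasFDerivAt).fderiv]
    rfl
  have hsum1 : ∀ x, u x * fderiv ℝ ψ x (A (x - p))
      = ∑ k, u x * fderiv ℝ (fun x => (A (x - p)) k * ψ x) x (EuclideanSpace.single k 1) := by
    intro x
    rw [← Finset.mul_sum]
    simp only [hd, Finset.sum_add_distrib, ← Finset.mul_sum, trace_eq_zero_of_skew hA, mul_zero,
      add_zero]
    rw [clm_apply_eq_sum (fderiv ℝ ψ x)]
    rfl
  have hsum2 : ∀ x, ψ x * ⟪A (x - p), g x⟫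
      = ∑ k, ((A (x - p)) k * ψ x) * ⟪g x, EuclideanSpace.single k 1⟫ := by
    intro x
    rw [PiLp.inner_apply, Finset.mul_sum]
    refine Finset.sum_congr rfl fun k _ => ?_
    rw [EuclideanSpace.inner_single_right]
    simp
    ring
  simp_rw [hsum1, hsum2]
  rw [integral_finsetSum _ fun k _ => integrable_left (ht k) _ u,
    integral_finsetSum _ fun k _ => integrable_right (ht k) _ g, ← Finset.sum_neg_distrib]
  exact Finset.sum_congr rfl fun k _ => hg _ (ht k) _

/-- The one-parameter group `u ↦ u ∘ Φ_t` on `L²(O)` generated by the rotations `Φ_t`. -/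
def rotPull (hO : IsOpen O) (hinv : ∀ t, rigid p (rot A hA t) ⁻¹' O = O) (t : ℝ) :
    L2 O →ₗᵢ[ℝ] L2 O :=
  pull hO (hinv t)

variable (hO : IsOpen O) (hinv : ∀ t, rigid p (rot A hA t) ⁻¹' O = O)

theorem rotPull_zero (u : L2 O) : rotPull hO hinv 0 u = u := by
  refine Lp.ext ?_
  filter_upwards [coeFn_pull hO (hinv 0) u] with x hx
  rw [rotPull, hx, rigid_rot_zero]

theorem rotPull_add (s t : ℝ) (u : L2 O) :
    rotPull hO hinv (s + t) u = rotPull hO hinv s (rotPull hO hinv t u) := by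
  refine Lp.ext ?_
  filter_upwards [coeFn_pull hO (hinv (s + t)) u, coeFn_pull hO (hinv s) (rotPull hO hinv t u),
    (measurePreserving_rigid_restrict hO (hinv s)).quasiMeasurePreserving.ae
      (coeFn_pull hO (hinv t) u)] with x h1 h2 h3
  rw [rotPull, h1, rotPull, h2, rotPull, h3, add_comm, rigid_rot_add]

theorem inner_rotPull (t : ℝ) (v u : L2 O) :
    ⟪v, rotPull hO hinv t u⟫ = ⟪rotPull hO hinv (-t) v, u⟫ := by
  have h : rotPull hO hinv t (rotPull hO hinv (-t) v) = v := by
    rw [← rotPull_add, add_neg_cancel, rotPull_zero]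
  conv_lhs => rw [← h]
  exact (rotPull hO hinv t).inner_map_map _ _

/-- The group commutes with B because exp(tA) commutes with A. -/
theorem rotPull_mem_transportGraph {u f : L2 O}
    (h : (u, f) ∈ transportGraph O fun x => A (x - p)) (t : ℝ) :
    (rotPull hO hinv t u, rotPull hO hinv t f) ∈ transportGraph O fun x => A (x - p) := by
  obtain ⟨g, hg, hf⟩ := h
  refine ⟨_, hg.pull hO (hinv t), ?_⟩
  filter_upwards [coeFn_pull hO (hinv t) f, coeFn_pullVec hO (hinv t) g,
    (measurePreserving_rigid_restrict hO (hinv t)).quasiMeasurePreserving.ae hf] with x h1 h2 h3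
  change (pull hO (hinv t) f) x = _
  rw [h1, h2, h3, ← (rot A hA t).inner_map_map (A (x - p)), rot_apply_comm,
    LinearIsometryEquiv.apply_symm_apply]
  simp [rigid]

/-- The flow is moved onto the smooth ψ as U_{-t}ψ, where one may differentiate under the integral;
the weak gradient then transfers the derivative back to u, and the two signs cancel. -/
theorem hasDerivAt_inner_testFunction_zero (hbd : Bornology.IsBounded O) {u f : L2 O}
    (h : (u, f) ∈ transportGraph O fun x => A (x - p)) {ψ : Eu d → ℝ} (hψ : IsTestFunction O ψ) :
    HasDerivAt (fun t => ⟪hψ.memLp.toLp ψ, rotPull hO hinv t u⟫) ⟪hψ.memLp.toLp ψ, f⟫ 0 := by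
  obtain ⟨g, hg, hf⟩ := h
  have hu : IntegrableOn u O := by
    have : IsFiniteMeasure ((volume : Measure (Eu d)).restrict O) :=
      ⟨by simpa using hbd.measure_lt_top⟩
    exact (Lp.memLp u).integrable (by norm_num)
  have h1 := hasDerivAt_setIntegral_comp_rigid (O := O) A hA p hu
    (hψ.contDiff.of_le (by simp)) hψ.hasCompactSupport 0
  simp only [rigid_rot_zero] at h1
  rw [hg.setIntegral_mul_fderiv_affine hA hψ] at h1
  have h2 : HasDerivAt (fun t : ℝ => -t) (-1) 0 := (hasDerivAt_id (0 : ℝ)).neg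
  rw [← neg_zero (G := ℝ)] at h1
  have h3 := h1.comp (0 : ℝ) h2
  have e1 : (fun t => ⟪hψ.memLp.toLp ψ, rotPull hO hinv t u⟫)
      = (fun s => ∫ x in O, u x * ψ (rigid p (rot A hA s) x)) ∘ fun t : ℝ => -t := by
    ext t
    rw [inner_rotPull, L2.inner_def]
    refine integral_congr_ae ?_
    filter_upwards [coeFn_pull hO (hinv (-t)) (hψ.memLp.toLp ψ),
      (measurePreserving_rigid_restrict hO (hinv (-t))).quasiMeasurePreserving.ae
        hψ.memLp.coeFn_toLp] with x hx1 hx2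
    rw [rotPull, hx1, hx2]
    simp
  have e2 : ⟪hψ.memLp.toLp ψ, f⟫ = (- ∫ x in O, ψ x * ⟪A (x - p), g x⟫) * (-1) := by
    rw [inner_toLp_eq, mul_neg_one, neg_neg]
    refine integral_congr_ae ?_
    filter_upwards [hf] with x hx
    rw [hx, mul_comm]
  rw [e1, e2]
  exact h3

/-- By the group law the derivative of ⟨ψ, U_t u⟩ at s is ⟨ψ, U_s f⟩, at most ‖ψ‖‖f‖; apply the mean
value inequality and duality. This bound lets test functions be replaced by arbitrary v in the weak
derivative. -/
theorem norm_rotPull_sub_le (hbd : Bornology.IsBounded O) {u f : L2 O}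
    (h : (u, f) ∈ transportGraph O fun x => A (x - p)) (t : ℝ) :
    ‖rotPull hO hinv t u - u‖ ≤ ‖f‖ * |t| := by
  refine norm_le_of_inner_testFunction_le hO (by positivity) fun ψ hψ => ?_
  have hd : ∀ s, HasDerivAt (fun t => ⟪hψ.memLp.toLp ψ, rotPull hO hinv t u⟫)
      ⟪hψ.memLp.toLp ψ, rotPull hO hinv s f⟫ s := by
    intro s
    have h1 := hasDerivAt_inner_testFunction_zero hO hinv hbd
      (rotPull_mem_transportGraph hO hinv h s) hψ
    simp only [← rotPull_add] at h1
    rw [← sub_self s] at h1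
    simpa using h1.comp_sub_const s s
  have hb := Convex.norm_image_sub_le_of_norm_hasDerivWithin_le
    (fun s _ => (hd s).hasDerivWithinAt) (C := ‖hψ.memLp.toLp ψ‖ * ‖f‖)
    (fun s _ => (norm_inner_le_norm _ _).trans_eq (by rw [LinearIsometry.norm_map]))
    convex_univ (mem_univ (0 : ℝ)) (mem_univ t)
  rw [rotPull_zero, ← inner_sub_right, sub_zero, Real.norm_eq_abs, Real.norm_eq_abs] at hb
  exact (le_abs_self _).trans (hb.trans_eq (by ring))

theorem hasDerivAt_inner_rotPull (hbd : Bornology.IsBounded O) {u f : L2 O}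
    (h : (u, f) ∈ transportGraph O fun x => A (x - p)) (v : L2 O) :
    HasDerivAt (fun t => ⟪v, rotPull hO hinv t u⟫) ⟪v, f⟫ 0 := by
  rw [hasDerivAt_iff_isLittleO_nhds_zero, Asymptotics.isLittleO_iff]
  intro ε hε
  -- The remainder z below satisfies ‖z‖ ≤ 2‖f‖|t|, so this accuracy makes the approximation error
  -- at most (ε/2)|t|; the +1 covers f = 0.
  obtain ⟨_, ⟨ψ, hψ, rfl⟩, hvψ⟩ := Metric.mem_closure_iff.1 (dense_testSubmodule hO v)
    (ε / (4 * (‖f‖ + 1))) (by positivity)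
  rw [dist_eq_norm, lt_div_iff₀ (by positivity)] at hvψ
  have h1 := hasDerivAt_inner_testFunction_zero hO hinv hbd h hψ
  rw [hasDerivAt_iff_isLittleO_nhds_zero, Asymptotics.isLittleO_iff] at h1
  filter_upwards [h1 (half_pos hε)] with t ht
  simp only [zero_add, rotPull_zero, ← inner_sub_right, smul_eq_mul,
    ← inner_smul_right] at ht ⊢
  set ψ' := hψ.memLp.toLp ψ
  set z := rotPull hO hinv t u - u - t • f
  have hz : ‖z‖ ≤ 2 * ‖f‖ * |t| := by
    refine (norm_sub_le _ _).trans ?_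
    rw [norm_smul, Real.norm_eq_abs]
    linarith [norm_rotPull_sub_le hO hinv hbd h t]
  have hsplit : ⟪v, z⟫ = ⟪v - ψ', z⟫ + ⟪ψ', z⟫ := by
    rw [← inner_add_left, sub_add_cancel]
  rw [Real.norm_eq_abs t] at ht ⊢
  have h2 : ‖⟪v - ψ', z⟫‖ ≤ ε / 2 * |t| := by
    refine (norm_inner_le_norm _ _).trans ?_
    have h3 : ‖v - ψ'‖ * ‖z‖ ≤ ‖v - ψ'‖ * (2 * ‖f‖ * |t|) :=
      mul_le_mul_of_nonneg_left hz (norm_nonneg _)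
    nlinarith [mul_le_mul_of_nonneg_right hvψ.le (abs_nonneg t),
      mul_nonneg (norm_nonneg (v - ψ')) (abs_nonneg t)]
  rw [hsplit]
  exact (norm_add_le _ _).trans (by linarith)

/-- The transport operator is skew-symmetric. -/
theorem inner_transport_comm (hO : IsOpen O)
    (hinv : ∀ t, rigid p (rot A hA t) ⁻¹' O = O) (hbd : Bornology.IsBounded O) {u f v e : L2 O}
    (hu : (u, f) ∈ transportGraph O fun x => A (x - p))
    (hv : (v, e) ∈ transportGraph O fun x => A (x - p)) : ⟪v, f⟫ = - ⟪u, e⟫ := by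
  have h1 := hasDerivAt_inner_rotPull hO hinv hbd hu v
  have h2 := hasDerivAt_inner_rotPull hO hinv hbd hv u
  rw [← neg_zero (G := ℝ)] at h2
  have h3 := h2.comp (0 : ℝ) (hasDerivAt_id (0 : ℝ)).neg
  -- Since U_t* = U_{-t}, both sides are the same function of t, with derivatives ⟨v, f⟩ and -⟨u, e⟩
  -- at 0.
  have e1 : (fun t => ⟪v, rotPull hO hinv t u⟫)
      = (fun t => ⟪u, rotPull hO hinv t v⟫) ∘ fun t : ℝ => -t := by
    ext t
    rw [inner_rotPull, real_inner_comm]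
    rfl
  rw [e1] at h1
  rw [h1.unique h3, mul_neg_one]

/-- J is symmetric and commutes with U_t, so ⟨v, U_t J u⟩ = ⟨J v, U_t u⟩; compare derivatives at 0.
That J u lies in H¹ is part of being a weak solution. -/
theorem resolvent_transport_comm (hO : IsOpen O)
    (hinv : ∀ t, rigid p (rot A hA t) ⁻¹' O = O) (hbd : Bornology.IsBounded O) {δ : ℝ} (hδ : 0 < δ)
    {J : L2 O →L[ℝ] L2 O} (hJ : ∀ f, IsWeakSolution O δ f (J f)) {u f : L2 O}
    (h : (u, f) ∈ transportGraph O fun x => A (x - p)) :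
    (J u, J f) ∈ transportGraph O fun x => A (x - p) := by
  obtain ⟨e, he⟩ : ∃ e, (J u, e) ∈ transportGraph O fun x => A (x - p) := by
    obtain ⟨g, hg, -⟩ := hJ u
    have hdom : J u ∈ (transportOperator O fun x => A (x - p)).domain := by
      rw [transportOperator_domain hO hbd (by fun_prop)]
      exact mem_H1.2 ⟨g, hg⟩
    rw [← transportOperator_graph hO]
    exact ⟨_, LinearPMap.mem_graph _ ⟨J u, hdom⟩⟩
  suffices e = J f by rwa [← this]
  refine ext_inner_left ℝ fun v => ?_
  have h1 := hasDerivAt_inner_rotPull hO hinv hbd he v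
  have h2 := hasDerivAt_inner_rotPull hO hinv hbd h (J v)
  have e1 : (fun t => ⟪v, rotPull hO hinv t (J u)⟫) = fun t => ⟪J v, rotPull hO hinv t u⟫ := by
    ext t
    have e2 : J (rotPull hO hinv t u) = rotPull hO hinv t (J u) :=
      (hJ _).unique hδ ((hJ u).pull hO (hinv t))
    rw [← e2, (hJ v).inner_comm (hJ _)]
  rw [e1] at h1
  rw [h1.unique h2, (hJ v).inner_comm (hJ f)]

end Generator

/-! ### The Neumann Laplacian, its resolvent and the core -/

section Neumann

variable {d : ℕ} {O : Set (Eu d)}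

theorem mem_graph_iff_exists_mem_domain {H : Type*} [NormedAddCommGroup H]
    [InnerProductSpace ℝ H] {T : H →ₗ.[ℝ] H} {u f : H} :
    (u, f) ∈ T.graph ↔ ∃ hu : u ∈ T.domain, T ⟨u, hu⟩ = f := by
  rw [LinearPMap.mem_graph_iff]
  constructor
  · rintro ⟨⟨y, hy⟩, rfl, h⟩
    exact ⟨hy, h⟩
  · rintro ⟨hu, h⟩
    exact ⟨⟨u, hu⟩, rfl, h⟩

theorem IsWeakSolution.mem_neumannLaplacianGraph {δ : ℝ} (hδ : 0 < δ) {f u : L2 O}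
    (h : IsWeakSolution O δ f u) : (u, δ⁻¹ • (u - f)) ∈ neumannLaplacianGraph O := by
  obtain ⟨g, hg, e⟩ := h
  refine ⟨g, hg, fun v w hw => ?_⟩
  have h1 := e v w hw
  rw [real_inner_smul_right, inner_sub_right, ← h1]
  field_simp
  ring

theorem isWeakSolution_of_mem_neumannLaplacianGraph (δ : ℝ) {u f : L2 O}
    (h : (u, f) ∈ neumannLaplacianGraph O) : IsWeakSolution O δ (u - δ • f) u := by
  obtain ⟨g, hg, e⟩ := h
  refine ⟨g, hg, fun v w hw => ?_⟩
  have h1 : ⟪v, f⟫ = - ⟪w, g⟫ := e v w hw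
  rw [inner_sub_right, real_inner_smul_right, h1]
  ring

theorem isResolvent_of_isWeakSolution (hO : IsOpen O) {δ : ℝ} (hδ : 0 < δ)
    {J : L2 O →L[ℝ] L2 O} (hJ : ∀ f, IsWeakSolution O δ f (J f)) :
    IsResolvent (neumannLaplacian O) δ J := by
  have h : ∀ f, ∃ hu : J f ∈ (neumannLaplacian O).domain,
      neumannLaplacian O ⟨J f, hu⟩ = δ⁻¹ • (J f - f) := fun f => by
    rw [← mem_graph_iff_exists_mem_domain, neumannLaplacian_graph hO]
    exact (hJ f).mem_neumannLaplacianGraph hδ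
  refine ⟨fun f => (h f).1, fun f => ?_, fun u => ?_⟩
  · rw [(h f).2, smul_smul, mul_inv_cancel₀ hδ.ne', one_smul, sub_sub_cancel]
  · have hu := (neumannLaplacian O).mem_graph u
    rw [neumannLaplacian_graph hO] at hu
    exact (hJ _).unique hδ (isWeakSolution_of_mem_neumannLaplacianGraph δ hu)

/-- An operator that is skew-symmetric and commutes with the resolvent of `A` satisfies
Shigekawa's conditions. -/
theorem exists_shigekawaConditions {H : Type*} [NormedAddCommGroup H] [InnerProductSpace ℝ H]
    [CompleteSpace H] {A B : H →ₗ.[ℝ] H} {J : H →L[ℝ] H} (hJ : IsResolvent A 1 J)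
    (hdense : Dense (B.domain : Set H)) (hAB : A.domain ≤ B.domain)
    (hskew : ∀ u v : B.domain, ⟪(v : H), B u⟫ = - ⟪(u : H), B v⟫)
    (hcomm : ∀ u f, (u, f) ∈ B.graph → (J u, J f) ∈ B.graph) :
    ∃ D, ShigekawaConditions A B D := by
  have hAJ : ∀ f (hf : J f ∈ A.domain), A ⟨J f, hf⟩ = J f - f := fun f hf => by
    have h := hJ.right_inv f
    rw [one_smul, sub_eq_iff_eq_add] at h
    rw [eq_sub_iff_add_eq, add_comm]
    exact h.symm
  have hD : B.domain.map J.toLinearMap ≤ A.domain := by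
    rintro _ ⟨f, -, rfl⟩
    exact hJ.mem_domain f
  -- The core is J(dom B): there A J f = J f - f stays in dom B, and B J f = J B f lies in dom A.
  refine ⟨B.domain.map J.toLinearMap, hD, hAB, ?_, ?_, ?_, ⟨hD, ?_⟩, ?_⟩
  · intro u hu
    refine LinearPMap.mem_adjoint_domain_of_exists u ⟨- B ⟨u, hAB hu⟩, fun v => ?_⟩
    rw [inner_neg_left, real_inner_comm, hskew v ⟨u, hAB hu⟩]
  · rintro _ ⟨f, hf, rfl⟩
    change A ⟨J f, _⟩ ∈ _
    rw [hAJ]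
    exact B.domain.sub_mem (hAB (hJ.mem_domain f)) hf
  · rintro _ ⟨f, hf, rfl⟩
    obtain ⟨h1, h2⟩ := mem_graph_iff_exists_mem_domain.1 (hcomm _ _ (B.mem_graph ⟨f, hf⟩))
    change B ⟨J f, _⟩ ∈ _
    rw [h2]
    exact hJ.mem_domain _
  · intro u ε hε
    set f : H := u - A u with hf
    have hu : J f = u := by simpa only [one_smul] using hJ.left_inv u
    -- As A J = J - Id is bounded, the graph distance from J f to J y depends continuously on y;
    -- density of dom B in H suffices.
    have hlim : ∃ y ∈ B.domain, ‖(J f - f) - (J y - y)‖ ^ 2 + ‖J f - J y‖ ^ 2 < ε ^ 2 := by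
      have hc : Continuous fun y => ‖(J f - f) - (J y - y)‖ ^ 2 + ‖J f - J y‖ ^ 2 := by fun_prop
      have hopen : IsOpen {y | ‖(J f - f) - (J y - y)‖ ^ 2 + ‖J f - J y‖ ^ 2 < ε ^ 2} :=
        isOpen_lt hc continuous_const
      obtain ⟨y, hy1, hy2⟩ := hdense.exists_mem_open hopen ⟨f, by simpa using by positivity⟩
      exact ⟨y, hy1, hy2⟩
    obtain ⟨y, hy, hlt⟩ := hlim
    refine ⟨⟨J y, hJ.mem_domain y⟩, ⟨y, hy, rfl⟩, ?_⟩
    have h1 : A u = J f - f := by rw [hu, hf]; abel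
    rw [LinearPMap.map_sub, hAJ, h1, ← hu]
    exact hlt
  · rintro _ ⟨f, hf, rfl⟩
    obtain ⟨h1, h2⟩ := mem_graph_iff_exists_mem_domain.1 (hcomm _ _ (B.mem_graph ⟨f, hf⟩))
    have h3 : (J f - f, J (B ⟨f, hf⟩) - B ⟨f, hf⟩) ∈ B.graph :=
      B.graph.sub_mem (x := (J f, J (B ⟨f, hf⟩))) (y := (f, B ⟨f, hf⟩))
        (hcomm _ _ (B.mem_graph ⟨f, hf⟩)) (B.mem_graph ⟨f, hf⟩)
    obtain ⟨h4, h5⟩ := mem_graph_iff_exists_mem_domain.1 h3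
    -- Both B A J f and A B J f equal J B f - B f. The free variable w allows rewriting despite the
    -- membership proofs.
    have hl : ∀ w (hw : w ∈ B.domain), w = J f - f → B ⟨w, hw⟩ = J (B ⟨f, hf⟩) - B ⟨f, hf⟩ := by
      rintro _ hw rfl
      exact h5
    have hr : ∀ w (hw : w ∈ A.domain), w = J (B ⟨f, hf⟩) →
        A ⟨w, hw⟩ = J (B ⟨f, hf⟩) - B ⟨f, hf⟩ := by
      rintro _ hw rfl
      exact hAJ _ _
    exact (hl _ _ (hAJ f _)).trans (hr _ _ h2).symm

theorem neumannLaplacian_domain_le_H1 (hO : IsOpen O) : (neumannLaplacian O).domain ≤ H1 O := by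
  intro u hu
  have h := (neumannLaplacian O).mem_graph ⟨u, hu⟩
  rw [neumannLaplacian_graph hO] at h
  obtain ⟨g, hg, -⟩ := h
  exact mem_H1.2 ⟨g, hg⟩

end Neumann

end NeumannKilling

end

theorem lemma2p7 {d N : ℕ} (O : Set (Eu d)) (hO_open : IsOpen O) (hO_conn : IsConnected O)
    (hO_bdd : Bornology.IsBounded O) (hO_bdry : HasC2Boundary O)
    (ν : Eu d → Eu d) (hν : ∀ x ∈ frontier O, IsOuterUnitNormalAt O x (ν x))
    (b : Fin N → Eu d → Eu d) (hb : NoiseAssumption O ν b) (i : Fin N) :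
    (transportOperator O (b i)).domain = H1 O ∧
    (∃ D : Submodule ℝ (L2 O),
      ShigekawaConditions (neumannLaplacian O) (transportOperator O (b i)) D) ∧
    ∀ δ : ℝ, 0 < δ → ∃ J : L2 O →L[ℝ] L2 O, IsResolvent (neumannLaplacian O) δ J ∧
      ∀ u : (transportOperator O (b i)).domain,
        ∃ hJu : J u ∈ (transportOperator O (b i)).domain,
          transportOperator O (b i) ⟨J u, hJu⟩ = J (transportOperator O (b i) u) := by
  have hdom := transportOperator_domain hO_open hO_bdd (hb.contDiffOn i).continuousOn
  obtain ⟨A, p, hA, htan, hbA⟩ := hb.exists_rotation hO_open hO_conn hO_bdd hO_bdry hν i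
  have hinv := preimage_rigid_rot hO_open hO_bdd hO_bdry A hA p htan
  have hgraph : (transportOperator O (b i)).graph = transportGraph O fun x => A (x - p) := by
    rw [transportOperator_graph hO_open, transportGraph_congr hO_open hbA]
  -- Obtained from the flow for every δ at once: δ = 1 yields the core, general δ the resolvent
  -- identity.
  have hcomm : ∀ δ > 0, ∀ J : L2 O →L[ℝ] L2 O, (∀ f, IsWeakSolution O δ f (J f)) →
      ∀ u f, (u, f) ∈ (transportOperator O (b i)).graph →
        (J u, J f) ∈ (transportOperator O (b i)).graph := by
    intro δ hδ J hJ u f h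
    rw [hgraph] at h ⊢
    exact resolvent_transport_comm hO_open hinv hO_bdd hδ hJ h
  refine ⟨hdom, ?_, fun δ hδ => ?_⟩
  · obtain ⟨J, hJ⟩ := exists_resolvent O one_pos
    refine exists_shigekawaConditions (isResolvent_of_isWeakSolution hO_open one_pos hJ) ?_ ?_ ?_
      (hcomm 1 one_pos J hJ)
    · rw [hdom]
      exact dense_H1 hO_open
    · rw [hdom]
      exact neumannLaplacian_domain_le_H1 hO_open
    · intro u v
      have hu := (transportOperator O (b i)).mem_graph u
      have hv := (transportOperator O (b i)).mem_graph v
      rw [hgraph] at hu hv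
      exact inner_transport_comm hO_open hinv hO_bdd hu hv
  · obtain ⟨J, hJ⟩ := exists_resolvent O hδ
    refine ⟨J, isResolvent_of_isWeakSolution hO_open hδ hJ, fun u => ?_⟩
    exact mem_graph_iff_exists_mem_domain.1
      (hcomm δ hδ J hJ _ _ ((transportOperator O (b i)).mem_graph u))
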